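/- Let $d\ge 3$, let $M\ge 2$ be real, and let $\mathbb P$ be a probability measure on $\mathbb R^{\mathbb Z^d}$ with its Borel (product) $\sigma$-algebra. Assume that $\mathbb P$ is invariant under all translations $(\gamma_z\omega)_y=\omega_{y+z}$, $z\in\mathbb Z^d$, and independent at distance $r\ge 0$: whenever $\Lambda(1),\dots,\Lambda(k)\subset\mathbb Z^d$ are finite, nonempty and have mutual $\ell^1$-distances $>r$, the restrictions $\omega\mapsto\omega|_{\Lambda(i)}$, $1\le i\le k$, are independent. (In particular $r$ may be the smallest such constant.) For $\omega\in\mathbb R^{\mathbb Z^d}$ let $H_\omega$ be the Anderson operator on $\ell^2(\mathbb Z^d)$, $(H_\omega\psi)(x)=\sum_{|y-x|_1=1}(\psi(x)-\psi(y))+\omega_x\psi(x)$, with domain $\{\psi\in\ell^2(\mathbb Z^d): H_\omega\psi\in\ell^2(\mathbb Z^d)\}$. For a finite nonempty $\Lambda\subset\mathbb Z^d$ let $H_\omega^\Lambda$ be the compression of $H_\omega$ to $\ell^2(\Lambda)$, and let $\bar N(\Lambda,\omega)(x)$ be the number of eigenvalues of $H_\omega^\Lambda$ that are $\le x$, counted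 with multiplicity, divided by $|\Lambda|$. Let $N(x)=\mathbb E\,\langle\delta_0,\mathbf 1_{(-\infty,x]}(H_\omega)\delta_0\rangle$ be the integrated density of states. Put $$K_M=\left(\frac{40(M+1)}{\log(3/2)\,(M-1)}+\frac{4}{\log M}\right)\sum_{q=0}^\infty 2^{-q}\sqrt{2+2q\log 2}.$$ Then the series converges and $$K_M<16\left(\frac{10(M+1)}{\log(3/2)\,(M-1)}+\frac1{\log M}\right).$$ Moreover, for every $n\in\mathbb N$ with $n>(2r+1)^2$ and $n>16$ and every cube $\Lambda_n\subset\mathbb Z^d$ of side length $n$ (a translate of $\{0,\dots,n-1\}^d$) there is a measurable set $A_{M,n}\subset\mathbb R^{\mathbb Z^d}$ such that for all $\omega\in A_{M,n}$ $$\sup_{x\in\mathbb R}\left|\bar N(\Lambda_n,\omega)(x)-N(x)\right|\le \frac{32d}{n}+\frac{104(2^d-1)}{\sqrt n}+\frac{8d+4r(2^d-1)+72dr+1}{\sqrt n-1},$$ and $$\mathbb P(A_{M,n})\ge 1-M\exp\left(-\frac{\sqrt{\lfloor n/\lfloor\sqrt n\rfloor\rfloor^d}}{\lfloor\sqrt n\rfloor\,K_M}\right).$$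 -/

import Mathlib

open MeasureTheory ProbabilityTheory

namespace Anderson

/-- The lattice `ℤ^d`. -/
abbrev Site (d : ℕ) := Fin d → ℤ

/-- Configurations `ω ∈ ℝ^{ℤ^d}`, with the product (equivalently Borel) `σ`-algebra. -/
abbrev Config (d : ℕ) := Site d → ℝ

/-- The `ℓ¹`-distance on `ℤ^d`. -/
def latticeDist {d : ℕ} (x y : Site d) : ℤ := ∑ i, |x i - y i|

/-- The translation `(γ_z ω)_y = ω_{y+z}`. -/
def shift {d : ℕ} (z : Site d) (ω : Config d) : Config d := fun y => ω (y + z)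

/-- Translation invariance of a measure on configurations. -/
def TranslationInvariant {d : ℕ} (P : Measure (Config d)) : Prop :=
  ∀ z : Site d, MeasurePreserving (shift z) P P

/-- Independence at distance `r`: the projections of `ω` to finitely many nonempty finite sets
with mutual distances larger than `r` are independent. -/
def IndependentAtDistance {d : ℕ} (P : Measure (Config d)) (r : ℝ) : Prop :=
  ∀ (k : ℕ) (Λ : Fin k → Finset (Site d)), (∀ i, (Λ i).Nonempty) →
    (∀ i j, i ≠ j → ∀ x ∈ Λ i, ∀ y ∈ Λ j, r < (latticeDist x y : ℝ)) →
    iIndepFun (fun i (ω : Config d) => (Λ i).restrict ω) P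

/-- The Anderson operator `(H_ω ψ)(x) = ∑_{|y - x| = 1} (ψ x - ψ y) + ω_x ψ x`; the neighbours
of `x` are `x + e_i` and `x - e_i`. It is defined here on all functions `ℤ^d → ℂ`. -/
def andersonOp {d : ℕ} (ω : Config d) : (Site d → ℂ) →ₗ[ℂ] (Site d → ℂ) where
  toFun ψ x := ∑ i, ((ψ x - ψ (x + Pi.single i 1)) + (ψ x - ψ (x - Pi.single i 1)))
    + (ω x : ℂ) * ψ x
  map_add' φ ψ := by
    funext x
    simp only [Pi.add_apply]
    rw [mul_add, add_add_add_comm, ← Finset.sum_add_distrib]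
    congr 1
    exact Finset.sum_congr rfl fun i _ => by ring
  map_smul' c ψ := by
    funext x
    simp only [Pi.smul_apply, smul_eq_mul, RingHom.id_apply]
    rw [mul_add, Finset.mul_sum]
    congr 1
    · exact Finset.sum_congr rfl fun i _ => by ring
    · ring

/-- The embedding `i_Λ`, extension by zero. -/
def embed {d : ℕ} (Λ : Finset (Site d)) : (Λ → ℂ) →ₗ[ℂ] (Site d → ℂ) where
  toFun φ z := if h : z ∈ Λ then φ ⟨z, h⟩ else 0
  map_add' φ ψ := by
    funext z
    by_cases h : z ∈ Λ <;> simp [h]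
  map_smul' c ψ := by
    funext z
    by_cases h : z ∈ Λ <;> simp [h]

/-- The projection `p_Λ`, restriction to `Λ`. -/
def proj {d : ℕ} (Λ : Finset (Site d)) : (Site d → ℂ) →ₗ[ℂ] (Λ → ℂ) :=
  LinearMap.funLeft ℂ ℂ Subtype.val

/-- The restricted Anderson operator `H_ω^Λ = p_Λ H_ω i_Λ`. -/
def restrictedOp {d : ℕ} (ω : Config d) (Λ : Finset (Site d)) : (Λ → ℂ) →ₗ[ℂ] (Λ → ℂ) :=
  proj Λ ∘ₗ andersonOp ω ∘ₗ embed Λ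

/-- The matrix of the restricted Anderson operator in the standard basis. -/
def restrictedMatrix {d : ℕ} (ω : Config d) (Λ : Finset (Site d)) : Matrix Λ Λ ℂ :=
  LinearMap.toMatrix' (restrictedOp ω Λ)

theorem embed_single {d : ℕ} (Λ : Finset (Site d)) (y : Λ) (z : Site d) :
    embed Λ (Pi.single y 1) z = if z = y.1 then 1 else 0 := by
  show (if h : z ∈ Λ then (Pi.single y (1 : ℂ) : Λ → ℂ) ⟨z, h⟩ else 0) = _
  by_cases hz : z = y.1
  · subst hz
    simp
  · by_cases h : z ∈ Λ
    · have : (⟨z, h⟩ : Λ) ≠ y := fun e => hz (congrArg Subtype.val e)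
      simp [h, hz, Pi.single_eq_of_ne this]
    · simp [h, hz]

theorem restrictedMatrix_apply {d : ℕ} (ω : Config d) (Λ : Finset (Site d)) (x y : Λ) :
    restrictedMatrix ω Λ x y =
      ∑ i, (((if x.1 = y.1 then 1 else 0) - (if x.1 + Pi.single i 1 = y.1 then 1 else 0))
        + ((if x.1 = y.1 then 1 else 0) - (if x.1 - Pi.single i 1 = y.1 then 1 else 0)))
      + (ω x.1 : ℂ) * (if x.1 = y.1 then 1 else 0) := by
  rw [restrictedMatrix, LinearMap.toMatrix'_apply]
  simp only [← embed_single]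
  rfl

theorem restrictedMatrix_isHermitian {d : ℕ} (ω : Config d) (Λ : Finset (Site d)) :
    (restrictedMatrix ω Λ).IsHermitian := by
  ext x y
  rw [Matrix.conjTranspose_apply, restrictedMatrix_apply, restrictedMatrix_apply]
  have h0 : (y.1 = x.1) ↔ (x.1 = y.1) := eq_comm
  have h1 : ∀ i, (y.1 + Pi.single i 1 = x.1) ↔ (x.1 - Pi.single i 1 = y.1) := fun i => by
    rw [sub_eq_iff_eq_add, eq_comm]
  have h2 : ∀ i, (y.1 - Pi.single i 1 = x.1) ↔ (x.1 + Pi.single i 1 = y.1) := fun i => by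
    rw [sub_eq_iff_eq_add, eq_comm]
  simp only [h0, h1, h2]
  rw [← starRingEnd_apply, map_add, map_sum, map_mul, Complex.conj_ofReal]
  congr 1
  · refine Finset.sum_congr rfl fun i _ => ?_
    simp only [map_add, map_sub, apply_ite (starRingEnd ℂ), map_one, map_zero]
    ring
  · by_cases h : x.1 = y.1
    · simp only [if_pos h, map_one]
      rw [h]
    · simp only [if_neg h, map_zero, mul_zero]

/-- The eigenvalue counting function: the number of eigenvalues of `H_ω^Λ`, with multiplicity,
that are at most `x`. -/
noncomputable def evcf {d : ℕ} (Λ : Finset (Site d)) (ω : Config d) (x : ℝ) : ℕ :=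
  (Finset.univ.filter fun i : Λ => (restrictedMatrix_isHermitian ω Λ).eigenvalues i ≤ x).card

/-- The normalized eigenvalue counting function. -/
noncomputable def normEvcf {d : ℕ} (Λ : Finset (Site d)) (ω : Config d) (x : ℝ) : ℝ :=
  (evcf Λ ω x : ℝ) / (Λ.card : ℝ)

/-- The cube of side length `n` with lower corner `a`. -/
noncomputable def cube {d : ℕ} (a : Site d) (n : ℕ) : Finset (Site d) :=
  Fintype.piFinset fun i => Finset.Ico (a i) (a i + (n : ℤ))

/-- `μ` is the spectral measure of the self-adjoint operator `H_ω` on `ℓ²(ℤ^d)` at `δ_x`, that is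
`μ(B) = ⟨δ_x, 1_B(H_ω) δ_x⟩`, expressed through the resolvent matrix elements
`⟨δ_x, (H_ω - z)⁻¹ δ_x⟩ = ∫ (t - z)⁻¹ dμ(t)` for all non-real `z`. The potential may be unbounded;
the domain of `H_ω` consists of the `ψ ∈ ℓ²` with `H_ω ψ ∈ ℓ²`, and `ψ` below is the vector
`(H_ω - z)⁻¹ δ_x`. -/
def IsSpectralMeasure {d : ℕ} (ω : Config d) (x : Site d) (μ : Measure ℝ) : Prop :=
  IsProbabilityMeasure μ ∧ ∀ z : ℂ, z.im ≠ 0 →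
    ∃ ψ : Site d → ℂ, Memℓp ψ 2 ∧ andersonOp ω ψ - z • ψ = Pi.single x 1 ∧
      ψ x = ∫ t : ℝ, ((t : ℂ) - z)⁻¹ ∂μ

/-- The spectral measure of `H_ω` at `δ_x`. -/
noncomputable def spectralMeasure {d : ℕ} (ω : Config d) (x : Site d) : Measure ℝ :=
  Classical.epsilon (IsSpectralMeasure ω x)

/-- The integrated density of states
`N(E) = 𝔼 Tr[1_{(-∞,E]}(H_ω) 1_{{0}}] = 𝔼 ⟨δ_0, 1_{(-∞,E]}(H_ω) δ_0⟩`. -/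
noncomputable def ids {d : ℕ} (P : Measure (Config d)) (E : ℝ) : ℝ :=
  ∫ ω, (spectralMeasure ω 0).real (Set.Iic E) ∂P

/-- The `q`-th term of the series in `K_M`. -/
noncomputable def seriesTerm (q : ℕ) : ℝ :=
  (2 : ℝ)⁻¹ ^ q * √(2 + 2 * (q : ℝ) * Real.log 2)

/-- The constant `K_M`. -/
noncomputable def constK (M : ℝ) : ℝ :=
  (40 * (M + 1) / (Real.log (3 / 2) * (M - 1)) + 4 / Real.log M) * ∑' q : ℕ, seriesTerm q

end Anderson

/-! Tile the cube of side `n` with pitch `m = ⌊√n⌋`, keeping in each tile a block of side `ℓ = m -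
g`, where the corridor width `g = max 1 ⌊r⌋` makes the blocks both decoupled and independent.
Deleting the other sites changes the eigenvalue count by at most their number
(`sum_countLE_le_and_le`), so the normalized count is close to the average of the block counts
(`abs_normEvcf_cube_sub_average_le`). The error is at most the deleted fraction of sites.

The block counts are independent with a common mean. Hoeffding's inequality at about `m` quantiles
of that mean, for the distribution functions and their left limits, gives a uniform error `2/m`
outside an event of probability at most `4m exp(-2kᵈ/m²)`, where `k = ⌊n/m⌋`
(`exists_measurableSet_forall_abs_averageReal_sub_le`). With `s = √(kᵈ)/m`, the inequalities `d ≥ 3`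
and `k ≥ m` give `s² ≥ m`, so this tail is below `M exp(-s/K_M)`; of `K_M` only `K_M ≥ 1` is needed.

It remains to compare the block mean with the integrated density of states (`abs_ids_sub_le`). The
tiling bound, taken in expectation, compares the block mean with the means over arbitrarily large
cubes. The Stieltjes transforms of the latter converge to that of the density of states, because
each diagonal Green function can be recentred at the origin by translation invariance and
finite-volume Green functions converge to the infinite-volume one (`tendsto_green_stieltjes`).
Arctangent inversion turns this into a bound on distribution functions at the cost of a factor 2.

The spectral measure is specified only through resolvents. Its existence, also for unbounded
potentials, comes from compactness (`exists_isSpectralMeasure`); its measurability comes from the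
convergence of Green functions. -/

namespace Anderson

/-! ### Eigenvalue counting and interlacing for Hermitian matrices. -/

section HermitianMatrix

open Matrix

variable {ι κ μ : Type*} [Fintype ι] [DecidableEq ι] [Fintype κ] [DecidableEq κ] [Fintype μ]
  [DecidableEq μ]

theorem star_dotProduct_self_eq_sum {ι : Type*} [Fintype ι] (v : ι → ℂ) : star v ⬝ᵥ v = ((∑ i, ‖v i‖ ^ 2 : ℝ) : ℂ) := by
  simp only [dotProduct, Pi.star_apply, RCLike.star_def, Complex.conj_mul']
  push_cast
  rfl

theorem star_dotProduct_diagonal_mulVec (b : ι → ℝ) (v : ι → ℂ) :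
    star v ⬝ᵥ (diagonal (fun i => (b i : ℂ)) *ᵥ v) = ((∑ i, b i * ‖v i‖ ^ 2 : ℝ) : ℂ) := by
  simp only [dotProduct, Pi.star_apply, RCLike.star_def, mulVec_diagonal]
  push_cast
  refine Finset.sum_congr rfl fun i _ => ?_
  rw [← Complex.conj_mul']
  ring

theorem star_mulVec_dotProduct_mulVec {ι κ : Type*} [Fintype ι] [Fintype κ] (D : Matrix ι κ ℂ) (v : κ → ℂ) (E : Matrix ι ι ℂ) :
    star (D *ᵥ v) ⬝ᵥ (E *ᵥ (D *ᵥ v)) = star v ⬝ᵥ ((Dᴴ * E * D) *ᵥ v) := by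
  rw [star_mulVec, ← dotProduct_mulVec, mulVec_mulVec, mulVec_mulVec, Matrix.mul_assoc]

/-- If the columns of `B` and `C` are orthonormal and diagonalize the quadratic form of `A`, then
the number of diagonal values `≤ x` for `B` plus the number of diagonal values `> x` for `C` is at
most the dimension. -/
theorem card_le_add_card_lt_le {A : Matrix ι ι ℂ} {B : Matrix ι κ ℂ} {C : Matrix ι μ ℂ}
    {b : κ → ℝ} {c : μ → ℝ} (hB : Bᴴ * B = 1) (hC : Cᴴ * C = 1)
    (hBA : Bᴴ * A * B = diagonal fun k => (b k : ℂ))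
    (hCA : Cᴴ * A * C = diagonal fun k => (c k : ℂ)) (x : ℝ) :
    (Finset.univ.filter fun k => b k ≤ x).card + (Finset.univ.filter fun k => x < c k).card ≤
      Fintype.card ι := by
  classical
  let extB : ({k // b k ≤ x} → ℂ) →ₗ[ℂ] (κ → ℂ) := Function.ExtendByZero.linearMap ℂ Subtype.val
  let extC : ({k // x < c k} → ℂ) →ₗ[ℂ] (μ → ℂ) := Function.ExtendByZero.linearMap ℂ Subtype.val
  have hextB : ∀ p k, ¬ b k ≤ x → extB p k = 0 := fun p k hk => by
    simp only [extB, Function.ExtendByZero.linearMap_apply]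
    rw [Function.extend_apply']
    · rfl
    · rintro ⟨y, rfl⟩; exact hk y.2
  have hextC : ∀ p k, ¬ x < c k → extC p k = 0 := fun p k hk => by
    simp only [extC, Function.ExtendByZero.linearMap_apply]
    rw [Function.extend_apply']
    · rfl
    · rintro ⟨y, rfl⟩; exact hk y.2
  have hextB' : ∀ p (k : {k // b k ≤ x}), extB p k = p k := fun p k => by
    simp only [extB, Function.ExtendByZero.linearMap_apply]
    exact Subtype.val_injective.extend_apply _ _ _
  have hextC' : ∀ p (k : {k // x < c k}), extC p k = p k := fun p k => by
    simp only [extC, Function.ExtendByZero.linearMap_apply]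
    exact Subtype.val_injective.extend_apply _ _ _
  -- The two selected column spans meet only in zero: on a common vector the quadratic form of `A -
  -- x` is nonpositive from one side and positive, unless the vector vanishes, from the other. Hence
  -- their dimensions add up to at most that of the whole space.
  let T : (({k // b k ≤ x} → ℂ) × ({k // x < c k} → ℂ)) →ₗ[ℂ] (ι → ℂ) :=
    (B.mulVecLin ∘ₗ extB).coprod (C.mulVecLin ∘ₗ extC)
  have hT : Function.Injective T := by
    rw [← LinearMap.ker_eq_bot, LinearMap.ker_eq_bot']
    rintro ⟨p, q⟩ hpq
    have hw : B *ᵥ extB p = C *ᵥ (-extC q) := by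
      have : B *ᵥ extB p + C *ᵥ extC q = 0 := by simpa [T] using hpq
      rw [mulVec_neg]
      exact eq_neg_of_add_eq_zero_left this
    have h1 : ∑ k, ‖extB p k‖ ^ 2 = ∑ k, ‖extC q k‖ ^ 2 := by
      have hb := star_mulVec_dotProduct_mulVec B (extB p) 1
      have hc := star_mulVec_dotProduct_mulVec C (-extC q) 1
      rw [Matrix.mul_one, hB, one_mulVec, one_mulVec,
        star_dotProduct_self_eq_sum (extB p)] at hb
      rw [Matrix.mul_one, hC, one_mulVec, one_mulVec,
        star_dotProduct_self_eq_sum (-extC q)] at hc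
      rw [hw, hc] at hb
      simpa using (Complex.ofReal_injective hb).symm
    have h2 : ∑ k, b k * ‖extB p k‖ ^ 2 = ∑ k, c k * ‖extC q k‖ ^ 2 := by
      have hb := star_mulVec_dotProduct_mulVec B (extB p) A
      have hc := star_mulVec_dotProduct_mulVec C (-extC q) A
      rw [hBA, star_dotProduct_diagonal_mulVec] at hb
      rw [hCA, star_dotProduct_diagonal_mulVec] at hc
      rw [hw, hc] at hb
      simpa using (Complex.ofReal_injective hb).symm
    have h3 : ∑ k, (b k - x) * ‖extB p k‖ ^ 2 ≤ 0 := by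
      refine Finset.sum_nonpos fun k _ => ?_
      by_cases hk : b k ≤ x
      · exact mul_nonpos_of_nonpos_of_nonneg (by linarith) (by positivity)
      · simp [hextB p k hk]
    have h4 : ∀ k ∈ Finset.univ, 0 ≤ (c k - x) * ‖extC q k‖ ^ 2 := by
      intro k _
      by_cases hk : x < c k
      · exact mul_nonneg (by linarith) (by positivity)
      · simp [hextC q k hk]
    have h5 : ∑ k, (c k - x) * ‖extC q k‖ ^ 2 = 0 := by
      refine le_antisymm ?_ (Finset.sum_nonneg h4)
      simp only [sub_mul, Finset.sum_sub_distrib, ← Finset.mul_sum] at h3 ⊢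
      rw [← h1, ← h2]
      exact h3
    have hq : ∀ k, extC q k = 0 := by
      intro k
      by_cases hk : x < c k
      · have := (Finset.sum_eq_zero_iff_of_nonneg h4).1 h5 k (Finset.mem_univ k)
        rcases mul_eq_zero.1 this with h | h
        · linarith
        · simpa using h
      · exact hextC q k hk
    have hp : ∀ k, extB p k = 0 := by
      have h0 : ∑ k, ‖extB p k‖ ^ 2 = 0 := by rw [h1]; simp [hq]
      intro k
      have := (Finset.sum_eq_zero_iff_of_nonneg fun k _ => by positivity).1 h0 k
        (Finset.mem_univ k)
      simpa using this
    refine Prod.ext (funext fun k => ?_) (funext fun k => ?_)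
    · exact (hextB' p k).symm.trans (hp k)
    · exact (hextC' q k).symm.trans (hq k)
  have := LinearMap.finrank_le_finrank_of_injective hT
  simpa [Module.finrank_prod, Fintype.card_subtype] using this

/-- The number of eigenvalues of a Hermitian matrix that are at most `x`. -/
noncomputable def countLE {A : Matrix ι ι ℂ} (hA : A.IsHermitian) (x : ℝ) : ℕ :=
  (Finset.univ.filter fun i => hA.eigenvalues i ≤ x).card

theorem countLE_add_card_lt {A : Matrix ι ι ℂ} (hA : A.IsHermitian) (x : ℝ) :
    countLE hA x + (Finset.univ.filter fun i => x < hA.eigenvalues i).card = Fintype.card ι := by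
  have := Finset.card_filter_add_card_filter_not (s := (Finset.univ : Finset ι))
    (fun i => hA.eigenvalues i ≤ x)
  simpa [countLE, not_le] using this

theorem eigenvectorUnitary_conjTranspose_mul_self {A : Matrix ι ι ℂ} (hA : A.IsHermitian) :
    (hA.eigenvectorUnitary : Matrix ι ι ℂ)ᴴ * (hA.eigenvectorUnitary : Matrix ι ι ℂ) = 1 :=
  Unitary.coe_star_mul_self _

theorem eigenvectorUnitary_mul_conjTranspose_self {A : Matrix ι ι ℂ} (hA : A.IsHermitian) :
    (hA.eigenvectorUnitary : Matrix ι ι ℂ) * (hA.eigenvectorUnitary : Matrix ι ι ℂ)ᴴ = 1 :=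
  Unitary.coe_mul_star_self _

theorem eigenvectorUnitary_conjTranspose_mul_mul {A : Matrix ι ι ℂ} (hA : A.IsHermitian) :
    (hA.eigenvectorUnitary : Matrix ι ι ℂ)ᴴ * A * (hA.eigenvectorUnitary : Matrix ι ι ℂ) =
      diagonal fun i => (hA.eigenvalues i : ℂ) := by
  have := hA.conjStarAlgAut_star_eigenvectorUnitary
  rw [Unitary.conjStarAlgAut_star_apply] at this
  exact this

/-- Interlacing for a decoupled family of principal submatrices. -/
theorem sum_countLE_le_and_le {J : Type*} [Fintype J] [DecidableEq J] {σ : J → Type*}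
    [∀ j, Fintype (σ j)] [∀ j, DecidableEq (σ j)] {A : Matrix ι ι ℂ} (hA : A.IsHermitian)
    {D : ∀ j, Matrix (σ j) (σ j) ℂ} (hD : ∀ j, (D j).IsHermitian) {f : (Σ j, σ j) → ι}
    (hf : Function.Injective f) (hAD : A.submatrix f f = blockDiagonal' D) (x : ℝ) :
    ∑ j, countLE (hD j) x ≤ countLE hA x ∧
      countLE hA x + ∑ j, Fintype.card (σ j) ≤ ∑ j, countLE (hD j) x + Fintype.card ι := by
  let E : Matrix ι (Σ j, σ j) ℂ := (1 : Matrix ι ι ℂ).submatrix id f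
  let U : Matrix (Σ j, σ j) (Σ j, σ j) ℂ :=
    blockDiagonal' fun j => ((hD j).eigenvectorUnitary : Matrix (σ j) (σ j) ℂ)
  have hE : ∀ G : Matrix ι ι ℂ, Eᴴ * G * E = G.submatrix f f := by
    intro G
    have h1 : Eᴴ = (1 : Matrix ι ι ℂ).submatrix f id := by
      simp [E, conjTranspose_submatrix]
    rw [h1]
    ext i j
    simp [E, Matrix.mul_apply, Matrix.one_apply]
  have hEE : Eᴴ * E = 1 := by
    have := hE 1
    rw [Matrix.mul_one] at this
    rw [this, submatrix_one _ hf]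
  have hUU : Uᴴ * U = 1 := by
    simp only [U, blockDiagonal'_conjTranspose, ← blockDiagonal'_mul,
      eigenvectorUnitary_conjTranspose_mul_self]
    exact blockDiagonal'_one
  let e : (Σ j, σ j) → ℝ := fun p => (hD p.1).eigenvalues p.2
  have hUA : Uᴴ * A.submatrix f f * U = diagonal fun p => (e p : ℂ) := by
    rw [hAD]
    simp only [U, blockDiagonal'_conjTranspose, ← blockDiagonal'_mul,
      eigenvectorUnitary_conjTranspose_mul_mul]
    exact blockDiagonal'_diagonal _
  have h1 : (E * U)ᴴ * (E * U) = 1 := by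
    rw [conjTranspose_mul, Matrix.mul_assoc, ← Matrix.mul_assoc Eᴴ, hEE, Matrix.one_mul, hUU]
  have h2 : (E * U)ᴴ * A * (E * U) = diagonal fun p => (e p : ℂ) := by
    rw [← hUA, ← hE A, conjTranspose_mul]
    simp only [Matrix.mul_assoc]
  -- The columns of `E * U` are the block eigenvectors extended by zero. The two inequalities come
  -- from the same dimension count with the two frames in either order.
  have c1 := card_le_add_card_lt_le h1 (eigenvectorUnitary_conjTranspose_mul_self hA) h2
    (eigenvectorUnitary_conjTranspose_mul_mul hA) x
  have c2 := card_le_add_card_lt_le (eigenvectorUnitary_conjTranspose_mul_self hA) h1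
    (eigenvectorUnitary_conjTranspose_mul_mul hA) h2 x
  have hcard : ∀ p : ℝ → Prop, [DecidablePred p] →
      (Finset.univ.filter fun q => p (e q)).card =
      ∑ j, (Finset.univ.filter fun k => p ((hD j).eigenvalues k)).card := by
    intro p _
    simp only [Finset.card_filter, Fintype.sum_sigma, e]
  rw [hcard (fun t => t ≤ x)] at c1
  rw [hcard (fun t => x < t)] at c2
  have t := countLE_add_card_lt hA x
  have tj := Finset.sum_congr rfl fun j (_ : j ∈ Finset.univ) => countLE_add_card_lt (hD j) x
  rw [Finset.sum_add_distrib] at tj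
  simp only [countLE] at t tj c1 c2 ⊢
  constructor <;> omega

/-- Interlacing with a single block of full size: nothing is deleted, so the two bounds coincide. -/
theorem countLE_submatrix_equiv {A : Matrix ι ι ℂ} (hA : A.IsHermitian) {B : Matrix κ κ ℂ}
    (hB : B.IsHermitian) (e : κ ≃ ι) (h : A.submatrix e e = B) (x : ℝ) :
    countLE hB x = countLE hA x := by
  have hf : Function.Injective fun p : (Σ _ : Unit, κ) => e p.2 := by
    rintro ⟨_, p⟩ ⟨_, q⟩ h
    simpa using h
  have := sum_countLE_le_and_le (J := Unit) (σ := fun _ => κ) hA (fun _ => hB)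
    (f := fun p => e p.2) hf (by
      rw [← h]
      ext ⟨_, p⟩ ⟨_, q⟩
      simp [blockDiagonal'_apply]) x
  simp [Fintype.card_congr e] at this
  omega

end HermitianMatrix

end Anderson

namespace Anderson

/-! ### Finitely supported measures. -/

section AtomicMeasure

variable {ι : Type*} [Fintype ι]

/-- The measure `∑ i, w i δ_{l i}`. -/
noncomputable def atomicMeasure (w l : ι → ℝ) : Measure ℝ :=
  ∑ i, ENNReal.ofReal (w i) • Measure.dirac (l i)

theorem integral_atomicMeasure {E : Type*} [NormedAddCommGroup E] [NormedSpace ℝ E]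
    [CompleteSpace E] {w : ι → ℝ} (hw : ∀ i, 0 ≤ w i) (l : ι → ℝ) (g : ℝ → E) :
    ∫ t, g t ∂atomicMeasure w l = ∑ i, w i • g (l i) := by
  rw [atomicMeasure, integral_finsetSum_measure]
  · refine Finset.sum_congr rfl fun i _ => ?_
    rw [integral_smul_measure, integral_dirac, ENNReal.toReal_ofReal (hw i)]
  · exact fun i _ => (integrable_dirac (by simp)).smul_measure ENNReal.ofReal_ne_top

theorem lintegral_atomicMeasure (w l : ι → ℝ) (g : ℝ → ENNReal) :
    ∫⁻ t, g t ∂atomicMeasure w l = ∑ i, ENNReal.ofReal (w i) * g (l i) := by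
  simp [atomicMeasure, lintegral_finsetSum_measure]

theorem isProbabilityMeasure_atomicMeasure {w : ι → ℝ} (hw : ∀ i, 0 ≤ w i) (h1 : ∑ i, w i = 1)
    (l : ι → ℝ) : IsProbabilityMeasure (atomicMeasure w l) := by
  constructor
  rw [← lintegral_one, lintegral_atomicMeasure]
  simp [← ENNReal.ofReal_sum_of_nonneg fun i _ => hw i, h1]

end AtomicMeasure

/-! ### Resolvents and spectral measures of Hermitian matrices. -/

section HermitianMatrix

open Matrix

variable {ι : Type*} [Fintype ι] [DecidableEq ι]

/-- Pair the equation with `v`: the form of `A` is real, so only `z` contributes to the imaginary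
part, and Cauchy–Schwarz finishes. This is the resolvent norm bound `1/|Im z|`. -/
theorem im_sq_mul_sum_sq_le {ι : Type*} [Fintype ι] {A : Matrix ι ι ℂ} (hA : A.IsHermitian)
    {z : ℂ} {v f : ι → ℂ} (h : A *ᵥ v - z • v = f) :
    z.im ^ 2 * ∑ i, ‖v i‖ ^ 2 ≤ ∑ i, ‖f i‖ ^ 2 := by
  have h1 : (star v ⬝ᵥ f).im = - (z.im * ∑ i, ‖v i‖ ^ 2) := by
    rw [← h, dotProduct_sub, dotProduct_smul, star_dotProduct_self_eq_sum, Complex.sub_im]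
    have := hA.im_star_dotProduct_mulVec_self v
    simp only [RCLike.im_to_complex] at this
    rw [this, smul_eq_mul, Complex.im_mul_ofReal, zero_sub]
  have h2 : ‖star v ⬝ᵥ f‖ ≤ ∑ i, ‖v i‖ * ‖f i‖ := by
    refine (norm_sum_le _ _).trans_eq ?_
    simp
  have h3 : (∑ i, ‖v i‖ * ‖f i‖) ^ 2 ≤ (∑ i, ‖v i‖ ^ 2) * ∑ i, ‖f i‖ ^ 2 :=
    Finset.sum_mul_sq_le_sq_mul_sq _ _ _
  have h4 : (z.im * ∑ i, ‖v i‖ ^ 2) ^ 2 ≤ (∑ i, ‖v i‖ ^ 2) * ∑ i, ‖f i‖ ^ 2 := by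
    refine le_trans ?_ h3
    rw [← neg_sq, ← h1, ← sq_abs]
    gcongr
    exact (Complex.abs_im_le_norm _).trans h2
  have h5 : 0 ≤ ∑ i, ‖v i‖ ^ 2 := Finset.sum_nonneg fun i _ => by positivity
  rcases h5.eq_or_lt with h6 | h6
  · rw [← h6, mul_zero]
    exact Finset.sum_nonneg fun i _ => by positivity
  · refine le_of_mul_le_mul_left ?_ h6
    calc _ = (z.im * ∑ i, ‖v i‖ ^ 2) ^ 2 := by ring
      _ ≤ _ := h4

/-- The resolvent `(A - z)⁻¹`. -/
noncomputable def resolventMatrix (A : Matrix ι ι ℂ) (z : ℂ) : Matrix ι ι ℂ :=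
  (A - z • (1 : Matrix ι ι ℂ))⁻¹

theorem resolventMatrix_eq {A : Matrix ι ι ℂ} (hA : A.IsHermitian) {z : ℂ} (hz : z.im ≠ 0) :
    resolventMatrix A z = (hA.eigenvectorUnitary : Matrix ι ι ℂ) *
      diagonal (fun i => ((hA.eigenvalues i : ℂ) - z)⁻¹) *
        (hA.eigenvectorUnitary : Matrix ι ι ℂ)ᴴ ∧
    resolventMatrix A z * (A - z • (1 : Matrix ι ι ℂ)) = 1 := by
  set U := (hA.eigenvectorUnitary : Matrix ι ι ℂ) with hU
  have h0 : Uᴴ * A = (diagonal fun i => (hA.eigenvalues i : ℂ)) * Uᴴ := by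
    rw [← eigenvectorUnitary_conjTranspose_mul_mul hA, Matrix.mul_assoc, ← hU,
      eigenvectorUnitary_mul_conjTranspose_self hA, Matrix.mul_one]
  have h1 : (U * diagonal (fun i => ((hA.eigenvalues i : ℂ) - z)⁻¹) * Uᴴ) *
      (A - z • (1 : Matrix ι ι ℂ)) = 1 := by
    have h2 : Uᴴ * (A - z • (1 : Matrix ι ι ℂ)) =
        (diagonal fun i => (hA.eigenvalues i : ℂ) - z) * Uᴴ := by
      rw [Matrix.mul_sub, h0, Matrix.mul_smul, Matrix.mul_one, ← diagonal_sub, Matrix.sub_mul]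
      congr 1
      ext i j
      simp [diagonal_mul]
    rw [Matrix.mul_assoc, h2, Matrix.mul_assoc, ← Matrix.mul_assoc (diagonal _), diagonal_mul_diagonal]
    have h3 : (fun i => ((hA.eigenvalues i : ℂ) - z)⁻¹ * ((hA.eigenvalues i : ℂ) - z)) =
        fun _ => 1 := by
      funext i
      refine inv_mul_cancel₀ fun h => hz ?_
      simpa using congrArg Complex.im h
    rw [h3, diagonal_one, Matrix.one_mul, hU, eigenvectorUnitary_mul_conjTranspose_self hA]
  have h4 := Matrix.inv_eq_left_inv h1
  refine ⟨h4, ?_⟩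
  rw [resolventMatrix, h4, h1]

theorem mul_resolventMatrix {A : Matrix ι ι ℂ} (hA : A.IsHermitian) {z : ℂ} (hz : z.im ≠ 0) :
    (A - z • (1 : Matrix ι ι ℂ)) * resolventMatrix A z = 1 :=
  mul_eq_one_comm.1 (resolventMatrix_eq hA hz).2

theorem mulVec_resolventMatrix_mulVec {A : Matrix ι ι ℂ} (hA : A.IsHermitian) {z : ℂ}
    (hz : z.im ≠ 0) (f : ι → ℂ) :
    A *ᵥ (resolventMatrix A z *ᵥ f) - z • (resolventMatrix A z *ᵥ f) = f := by
  have := congrArg (fun B => B *ᵥ f) (mul_resolventMatrix hA hz)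
  simpa [← mulVec_mulVec, sub_mulVec, smul_mulVec] using this

theorem resolventMatrix_mulVec_sub {A : Matrix ι ι ℂ} (hA : A.IsHermitian) {z : ℂ}
    (hz : z.im ≠ 0) (v : ι → ℂ) :
    resolventMatrix A z *ᵥ (A *ᵥ v - z • v) = v := by
  have := congrArg (fun B => B *ᵥ v) (resolventMatrix_eq hA hz).2
  simpa [← mulVec_mulVec, sub_mulVec, smul_mulVec] using this

theorem sum_norm_sq_eigenvectorUnitary {A : Matrix ι ι ℂ} (hA : A.IsHermitian) (x : ι) :
    ∑ i, ‖(hA.eigenvectorUnitary : Matrix ι ι ℂ) x i‖ ^ 2 = 1 := by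
  have := congrFun (congrFun (eigenvectorUnitary_mul_conjTranspose_self hA) x) x
  simp only [Matrix.mul_apply, conjTranspose_apply, RCLike.star_def, Complex.mul_conj',
    one_apply_eq] at this
  exact_mod_cast this

/-- The spectral measure of a Hermitian matrix at a standard basis vector. -/
noncomputable def matrixSpectralMeasure {A : Matrix ι ι ℂ} (hA : A.IsHermitian) (x : ι) :
    Measure ℝ :=
  atomicMeasure (fun i => ‖(hA.eigenvectorUnitary : Matrix ι ι ℂ) x i‖ ^ 2) hA.eigenvalues

instance {A : Matrix ι ι ℂ} (hA : A.IsHermitian) (x : ι) :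
    IsProbabilityMeasure (matrixSpectralMeasure hA x) :=
  isProbabilityMeasure_atomicMeasure (fun _ => by positivity)
    (sum_norm_sq_eigenvectorUnitary hA x) _

theorem integral_matrixSpectralMeasure {A : Matrix ι ι ℂ} (hA : A.IsHermitian) (x : ι) {z : ℂ}
    (hz : z.im ≠ 0) :
    ∫ t : ℝ, ((t : ℂ) - z)⁻¹ ∂matrixSpectralMeasure hA x = resolventMatrix A z x x := by
  rw [matrixSpectralMeasure, integral_atomicMeasure fun _ => by positivity,
    (resolventMatrix_eq hA hz).1, Matrix.mul_apply]
  refine Finset.sum_congr rfl fun i _ => ?_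
  rw [mul_diagonal, conjTranspose_apply, RCLike.star_def, Complex.real_smul, mul_right_comm,
    Complex.mul_conj']
  push_cast
  rfl

/-- The second moment is the squared norm of a column of `A`. For restrictions of the Anderson
operator this is bounded uniformly in the volume, which later yields tightness. -/
theorem lintegral_sq_matrixSpectralMeasure {A : Matrix ι ι ℂ} (hA : A.IsHermitian) (x : ι) :
    ∫⁻ t : ℝ, ENNReal.ofReal (t ^ 2) ∂matrixSpectralMeasure hA x =
      ENNReal.ofReal (∑ y, ‖A y x‖ ^ 2) := by
  set U := (hA.eigenvectorUnitary : Matrix ι ι ℂ) with hU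
  rw [matrixSpectralMeasure, lintegral_atomicMeasure]
  simp only [← ENNReal.ofReal_mul (sq_nonneg _)]
  rw [← ENNReal.ofReal_sum_of_nonneg fun i _ => by positivity]
  congr 1
  have h0 : Uᴴ * A = (diagonal fun i => (hA.eigenvalues i : ℂ)) * Uᴴ := by
    rw [← eigenvectorUnitary_conjTranspose_mul_mul hA, Matrix.mul_assoc, ← hU,
      eigenvectorUnitary_mul_conjTranspose_self hA, Matrix.mul_one]
  have h1 : Aᴴ * A = (U * diagonal fun i => (hA.eigenvalues i : ℂ)) *
      ((diagonal fun i => (hA.eigenvalues i : ℂ)) * Uᴴ) := by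
    have h2 : Aᴴ * U = U * diagonal fun i => (hA.eigenvalues i : ℂ) := by
      have := congrArg conjTranspose h0
      rw [conjTranspose_mul, conjTranspose_mul, conjTranspose_conjTranspose,
        diagonal_conjTranspose] at this
      rw [this]
      congr 2
      funext i
      simp
    rw [← h0, ← h2, Matrix.mul_assoc, ← Matrix.mul_assoc U,
      eigenvectorUnitary_mul_conjTranspose_self hA, Matrix.one_mul]
  have h3 := congrFun (congrFun h1 x) x
  rw [Matrix.mul_apply, Matrix.mul_apply] at h3
  simp only [mul_diagonal, diagonal_mul, conjTranspose_apply, RCLike.star_def,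
    Complex.conj_mul'] at h3
  rw [← Complex.ofReal_inj]
  push_cast
  rw [h3]
  refine Finset.sum_congr rfl fun i _ => ?_
  rw [← Complex.mul_conj']
  ring

/-- The normalized eigenvalue distribution of a Hermitian matrix. -/
noncomputable def empiricalMeasure {A : Matrix ι ι ℂ} (hA : A.IsHermitian) : Measure ℝ :=
  atomicMeasure (fun _ => (Fintype.card ι : ℝ)⁻¹) hA.eigenvalues

instance [Nonempty ι] {A : Matrix ι ι ℂ} (hA : A.IsHermitian) :
    IsProbabilityMeasure (empiricalMeasure hA) :=
  isProbabilityMeasure_atomicMeasure (fun _ => by positivity) (by simp) _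

theorem empiricalMeasure_real_Iic {A : Matrix ι ι ℂ} (hA : A.IsHermitian) (x : ℝ) :
    (empiricalMeasure hA).real (Set.Iic x) = countLE hA x / Fintype.card ι := by
  rw [← integral_indicator_one measurableSet_Iic, empiricalMeasure,
    integral_atomicMeasure fun _ => by positivity, ← Finset.smul_sum, smul_eq_mul, countLE,
    Finset.card_filter, div_eq_inv_mul]
  push_cast
  simp [Set.indicator_apply]

theorem integral_empiricalMeasure {A : Matrix ι ι ℂ} (hA : A.IsHermitian) {z : ℂ}
    (hz : z.im ≠ 0) :
    ∫ t : ℝ, ((t : ℂ) - z)⁻¹ ∂empiricalMeasure hA =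
      (Fintype.card ι : ℝ)⁻¹ • ∑ x, resolventMatrix A z x x := by
  rw [empiricalMeasure, integral_atomicMeasure fun _ => by positivity, ← Finset.smul_sum]
  congr 1
  have h : ∑ x, resolventMatrix A z x x = Matrix.trace (resolventMatrix A z) := rfl
  rw [h, (resolventMatrix_eq hA hz).1, Matrix.trace_mul_cycle,
    eigenvectorUnitary_conjTranspose_mul_self, Matrix.one_mul, trace_diagonal]

theorem resolventMatrix_submatrix_equiv {κ : Type*} [Fintype κ] [DecidableEq κ]
    (A : Matrix ι ι ℂ) (z : ℂ) (e : κ ≃ ι) :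
    resolventMatrix (A.submatrix e e) z = (resolventMatrix A z).submatrix e e := by
  rw [resolventMatrix, resolventMatrix, ← Matrix.inv_submatrix_equiv]
  congr 1
  ext i j
  simp [Matrix.one_apply]

end HermitianMatrix

end Anderson

namespace Anderson

/-! ### Stieltjes transforms and their inversion. -/

section Stieltjes

open Filter Topology

/-- The Stieltjes transform of a measure. -/
noncomputable def stieltjes (μ : Measure ℝ) (z : ℂ) : ℂ := ∫ t : ℝ, ((t : ℂ) - z)⁻¹ ∂μ

theorem ofReal_sub_ne_zero {z : ℂ} (hz : z.im ≠ 0) (t : ℝ) : (t : ℂ) - z ≠ 0 := fun h => hz <| by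
  simpa using congrArg Complex.im h

theorem norm_inv_sub_le {z : ℂ} (hz : z.im ≠ 0) (t : ℝ) : ‖((t : ℂ) - z)⁻¹‖ ≤ |z.im|⁻¹ := by
  rw [norm_inv]
  have := Complex.abs_im_le_norm ((t : ℂ) - z)
  simp only [Complex.sub_im, Complex.ofReal_im, zero_sub, abs_neg] at this
  have := abs_pos.2 hz
  gcongr

theorem continuous_inv_sub {z : ℂ} (hz : z.im ≠ 0) : Continuous fun t : ℝ => ((t : ℂ) - z)⁻¹ :=
  (Complex.continuous_ofReal.sub continuous_const).inv₀ (ofReal_sub_ne_zero hz)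

theorem integrable_inv_sub (μ : Measure ℝ) [IsFiniteMeasure μ] {z : ℂ} (hz : z.im ≠ 0) :
    Integrable (fun t : ℝ => ((t : ℂ) - z)⁻¹) μ :=
  .of_bound (continuous_inv_sub hz).aestronglyMeasurable _ (.of_forall (norm_inv_sub_le hz))

theorem norm_stieltjes_le (μ : Measure ℝ) [IsProbabilityMeasure μ] {z : ℂ} (hz : z.im ≠ 0) :
    ‖stieltjes μ z‖ ≤ |z.im|⁻¹ := by
  have := norm_integral_le_of_norm_le_const (μ := μ) (.of_forall (norm_inv_sub_le hz))
  simpa [stieltjes] using this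

theorem continuous_stieltjes_line (μ : Measure ℝ) [IsFiniteMeasure μ] {η : ℝ} (hη : η ≠ 0) :
    Continuous fun s : ℝ => stieltjes μ (s + η * Complex.I) := by
  have him : ∀ s : ℝ, ((s : ℂ) + η * Complex.I).im = η := fun s => by simp
  refine continuous_of_dominated (bound := fun _ => |η|⁻¹) (fun s => ?_) (fun s => ?_)
    (integrable_const _) (.of_forall fun t => ?_)
  · exact (continuous_inv_sub (by rwa [him])).aestronglyMeasurable
  · refine .of_forall fun t => ?_
    have := norm_inv_sub_le (z := (s : ℂ) + η * Complex.I) (by rwa [him]) t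
    rwa [him] at this
  · refine Continuous.inv₀ (by fun_prop) fun s => ofReal_sub_ne_zero (by rwa [him]) t

theorem im_inv_sub (t s η : ℝ) :
    (((t : ℂ) - (s + η * Complex.I))⁻¹).im = η / ((t - s) ^ 2 + η ^ 2) := by
  rw [Complex.inv_im, Complex.normSq_apply]
  simp
  ring

theorem integral_poisson (t a b : ℝ) {η : ℝ} (hη : 0 < η) :
    ∫ s in a..b, η / ((t - s) ^ 2 + η ^ 2) =
      Real.arctan ((b - t) / η) - Real.arctan ((a - t) / η) := by
  have hpos : ∀ s : ℝ, (t - s) ^ 2 + η ^ 2 ≠ 0 := fun s => by positivity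
  refine intervalIntegral.integral_eq_sub_of_hasDerivAt
    (f := fun s => Real.arctan ((s - t) / η)) (fun s _ => ?_)
    (Continuous.intervalIntegrable (by fun_prop (disch := exact hpos _)) _ _)
  have h := (((hasDerivAt_id s).sub_const t).div_const η).arctan
  have h1 : η / ((t - s) ^ 2 + η ^ 2) = 1 / (1 + ((id s - t) / η) ^ 2) * (1 / η) := by
    have h2 : 1 + ((s - t) / η) ^ 2 ≠ 0 := by positivity
    have h3 := hpos s
    simp only [id]
    field_simp
    ring
  rw [h1]
  exact h

/-- Fubini: the imaginary part of the transform is a Poisson integral, and the Poisson kernel has an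
arctangent primitive. -/
theorem integral_im_stieltjes (μ : Measure ℝ) [IsFiniteMeasure μ] (a b : ℝ) {η : ℝ}
    (hη : 0 < η) :
    ∫ s in a..b, (stieltjes μ (s + η * Complex.I)).im =
      ∫ t, (Real.arctan ((b - t) / η) - Real.arctan ((a - t) / η)) ∂μ := by
  have him : ∀ s : ℝ, ((s : ℂ) + η * Complex.I).im ≠ 0 := fun s => by simpa using hη.ne'
  have h1 : ∀ s : ℝ, (stieltjes μ (s + η * Complex.I)).im =
      ∫ t, η / ((t - s) ^ 2 + η ^ 2) ∂μ := fun s => by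
    have := integral_im (𝕜 := ℂ) (integrable_inv_sub μ (him s))
    simp only [RCLike.im_to_complex] at this
    rw [stieltjes, ← this]
    simp only [im_inv_sub]
  simp only [h1]
  rw [intervalIntegral_integral_swap]
  · simp only [integral_poisson _ _ _ hη]
  · have : IsFiniteMeasure (volume.restrict (Set.uIoc a b)) := ⟨by simp [Set.uIoc]⟩
    refine .of_bound (C := η⁻¹) (Continuous.aestronglyMeasurable ?_) (.of_forall fun p => ?_)
    · have : ∀ p : ℝ × ℝ, (p.2 - p.1) ^ 2 + η ^ 2 ≠ 0 := fun p => by positivity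
      simp only [Function.uncurry_def]
      fun_prop (disch := exact this _)
    · simp only [Function.uncurry_def]
      rw [Real.norm_of_nonneg (by positivity), div_le_iff₀ (by positivity)]
      have : 0 ≤ η⁻¹ * (p.2 - p.1) ^ 2 := by positivity
      have h2 : η⁻¹ * η ^ 2 = η := by field_simp
      linarith

/-- Approximations of the indicator function of `(-∞, x]` by differences of arctangents. -/
noncomputable def arctanApprox (x : ℝ) (j : ℕ) (t : ℝ) : ℝ :=
  Real.pi⁻¹ * (Real.arctan ((x + 1 / (j + 1) - t) / (1 / (j + 1) ^ 2)) -
    Real.arctan ((-(j + 1) - t) / (1 / (j + 1) ^ 2)))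

/-- The approximate inversion formula for Stieltjes transforms. -/
noncomputable def stieltjesInversion (S : ℂ → ℂ) (x : ℝ) (j : ℕ) : ℝ :=
  Real.pi⁻¹ * ∫ s in (-(j + 1) : ℝ)..(x + 1 / (j + 1)),
    (S (s + ((1 / (j + 1) ^ 2 : ℝ) : ℂ) * Complex.I)).im

theorem stieltjesInversion_stieltjes (μ : Measure ℝ) [IsFiniteMeasure μ] (x : ℝ) (j : ℕ) :
    stieltjesInversion (stieltjes μ) x j = ∫ t, arctanApprox x j t ∂μ := by
  have h : (0 : ℝ) < 1 / (j + 1) ^ 2 := by positivity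
  simp only [arctanApprox]
  rw [stieltjesInversion, integral_im_stieltjes μ _ _ h, integral_const_mul]

theorem tendsto_arctanApprox (x t : ℝ) :
    Tendsto (fun j => arctanApprox x j t) atTop (𝓝 (Set.indicator (Set.Iic x) 1 t)) := by
  have hn : Tendsto (fun j : ℕ => (j : ℝ) + 1) atTop atTop :=
    tendsto_atTop_add_const_right _ _ tendsto_natCast_atTop_atTop
  have hA : Tendsto (fun j : ℕ => Real.arctan ((-((j : ℝ) + 1) - t) / (1 / ((j : ℝ) + 1) ^ 2)))
      atTop (𝓝 (-(Real.pi / 2))) := by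
    refine (Real.tendsto_arctan_atBot.mono_right nhdsWithin_le_nhds).comp ?_
    have h1 : Tendsto (fun y : ℝ => (-y - t) * y ^ 2) atTop atBot := by
      refine Tendsto.atBot_mul_atTop₀ ?_ (tendsto_pow_atTop two_ne_zero)
      exact tendsto_atBot_add_const_right _ _ tendsto_neg_atTop_atBot
    refine (h1.comp hn).congr fun j => ?_
    simp
  have hB : Tendsto (fun j : ℕ => Real.arctan ((x + 1 / ((j : ℝ) + 1) - t) /
      (1 / ((j : ℝ) + 1) ^ 2))) atTop
      (𝓝 (if t ≤ x then Real.pi / 2 else -(Real.pi / 2))) := by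
    -- The endpoint is shifted by more than the smoothing width, so at `t = x` the argument is still
    -- `j + 1`, which tends to infinity; the limit is therefore the indicator of the closed
    -- half-line.
    have h0 : ∀ j : ℕ, (x + 1 / ((j : ℝ) + 1) - t) / (1 / ((j : ℝ) + 1) ^ 2) =
        ((x - t) * ((j : ℝ) + 1) + 1) * ((j : ℝ) + 1) := fun j => by
      field_simp
      ring
    simp only [h0]
    split_ifs with hx
    · refine (Real.tendsto_arctan_atTop.mono_right nhdsWithin_le_nhds).comp ?_
      refine tendsto_atTop_mono (fun j => ?_) hn
      have : 0 ≤ (x - t) * ((j : ℝ) + 1) := mul_nonneg (by linarith) (by positivity)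
      nlinarith [(by positivity : (0 : ℝ) ≤ (j : ℝ) + 1)]
    · refine (Real.tendsto_arctan_atBot.mono_right nhdsWithin_le_nhds).comp ?_
      refine Tendsto.atBot_mul_atTop₀ ?_ hn
      refine tendsto_atBot_add_const_right _ _ ?_
      exact hn.const_mul_atTop_of_neg (by linarith [not_le.1 hx])
  have h := (hB.sub hA).const_mul Real.pi⁻¹
  simp only [arctanApprox]
  convert h using 2
  have := Real.pi_ne_zero
  by_cases hx : t ≤ x <;> simp [hx]

theorem abs_arctanApprox_le (x : ℝ) (j : ℕ) (t : ℝ) : |arctanApprox x j t| ≤ 1 := by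
  rw [arctanApprox, abs_mul, abs_of_pos (by positivity), inv_mul_le_iff₀ Real.pi_pos, abs_le]
  constructor <;> linarith [Real.arctan_lt_pi_div_two
    ((x + 1 / ((j : ℝ) + 1) - t) / (1 / ((j : ℝ) + 1) ^ 2)), Real.neg_pi_div_two_lt_arctan
    ((x + 1 / ((j : ℝ) + 1) - t) / (1 / ((j : ℝ) + 1) ^ 2)), Real.arctan_lt_pi_div_two
    ((-((j : ℝ) + 1) - t) / (1 / ((j : ℝ) + 1) ^ 2)), Real.neg_pi_div_two_lt_arctan
    ((-((j : ℝ) + 1) - t) / (1 / ((j : ℝ) + 1) ^ 2))]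

theorem continuous_arctanApprox (x : ℝ) (j : ℕ) : Continuous (arctanApprox x j) := by
  unfold arctanApprox
  fun_prop

theorem tendsto_stieltjesInversion (μ : Measure ℝ) [IsFiniteMeasure μ] (x : ℝ) :
    Tendsto (stieltjesInversion (stieltjes μ) x) atTop (𝓝 (μ.real (Set.Iic x))) := by
  rw [← integral_indicator_one measurableSet_Iic]
  simp only [funext (stieltjesInversion_stieltjes μ x)]
  refine tendsto_integral_of_dominated_convergence (fun _ => 1)
    (fun j => (continuous_arctanApprox x j).aestronglyMeasurable) (integrable_const _)
    (fun j => .of_forall fun t => ?_) (.of_forall fun t => tendsto_arctanApprox x t)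
  exact abs_arctanApprox_le x j t

/-- A family of probability measures is measurable if its Stieltjes transforms are. -/
theorem measurable_of_measurable_stieltjes {α : Type*} [MeasurableSpace α] {κ : α → Measure ℝ}
    [∀ a, IsProbabilityMeasure (κ a)]
    (h : ∀ z : ℂ, z.im ≠ 0 → Measurable fun a => stieltjes (κ a) z) : Measurable κ := by
  refine .measure_of_isPiSystem_of_isProbabilityMeasure (borel_eq_generateFrom_Iic ℝ)
    isPiSystem_Iic ?_
  rintro _ ⟨x, rfl⟩
  have h1 : Measurable fun a => (κ a).real (Set.Iic x) := by
    refine measurable_of_tendsto_metrizable (fun j => ?_)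
      (tendsto_pi_nhds.2 fun a => tendsto_stieltjesInversion (κ a) x)
    refine Measurable.const_mul ?_ _
    have hη : (1 / ((j : ℝ) + 1) ^ 2 : ℝ) ≠ 0 := by positivity
    have h2 : StronglyMeasurable (Function.uncurry fun (s : ℝ) (a : α) =>
        stieltjes (κ a) (s + ((1 / (j + 1) ^ 2 : ℝ) : ℂ) * Complex.I)) := by
      refine stronglyMeasurable_uncurry_of_continuous_of_stronglyMeasurable
        (fun a => continuous_stieltjes_line (κ a) hη) fun s => ?_
      refine (h _ ?_).stronglyMeasurable
      rw [Complex.add_im, Complex.ofReal_im, zero_add, Complex.im_ofReal_mul, Complex.I_im, mul_one]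
      exact hη
    have h3 : Measurable (Function.uncurry fun (a : α) (s : ℝ) =>
        (stieltjes (κ a) (s + ((1 / (j + 1) ^ 2 : ℝ) : ℂ) * Complex.I)).im) :=
      Complex.measurable_im.comp (h2.measurable.comp measurable_swap)
    simp only [intervalIntegral]
    exact (h3.stronglyMeasurable.integral_prod_right.sub
      h3.stronglyMeasurable.integral_prod_right).measurable
  have h4 : (fun a => κ a (Set.Iic x)) = fun a => ENNReal.ofReal ((κ a).real (Set.Iic x)) :=
    funext fun a => (ofReal_measureReal).symm
  rw [h4]
  exact h1.ennreal_ofReal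

theorem IsLowerSet.eq_Iic_csSup {s : Set ℝ} (hs : IsLowerSet s) (hc : IsClosed s)
    (hne : s.Nonempty) (hb : BddAbove s) : s = Set.Iic (sSup s) :=
  Set.Subset.antisymm (fun _ hx => le_csSup hb hx) fun _ hx => hs hx (hc.csSup_mem hne hb)

/-- Layer cake: each superlevel set of `f` is a closed lower set, hence empty, the whole line or a
closed half-line, and on each of these the two measures differ by at most `c`. -/
theorem abs_integral_sub_le_of_antitone {ν ρ : Measure ℝ} [IsProbabilityMeasure ν]
    [IsProbabilityMeasure ρ] {c : ℝ} (h : ∀ x, |ν.real (Set.Iic x) - ρ.real (Set.Iic x)| ≤ c)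
    {f : ℝ → ℝ} (hf : Antitone f) (hfc : Continuous f) (h0 : ∀ x, 0 ≤ f x) (h1 : ∀ x, f x ≤ 1) :
    |∫ t, f t ∂ν - ∫ t, f t ∂ρ| ≤ c := by
  have hc : 0 ≤ c := (abs_nonneg _).trans (h 0)
  have hlc : ∀ (μ : Measure ℝ) [IsProbabilityMeasure μ],
      ∫ t, f t ∂μ = ∫ u in (0 : ℝ)..1, μ.real {t | u ≤ f t} := fun μ _ => by
    rw [intervalIntegral.integral_of_le zero_le_one]
    refine Integrable.integral_eq_integral_Ioc_meas_le ?_ (.of_forall h0) (.of_forall h1)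
    refine .of_bound hfc.aestronglyMeasurable 1 (.of_forall fun t => ?_)
    rw [Real.norm_of_nonneg (h0 t)]
    exact h1 t
  have hint : ∀ (μ : Measure ℝ) [IsProbabilityMeasure μ],
      IntervalIntegrable (fun u => μ.real {t | u ≤ f t}) volume 0 1 := fun μ _ =>
    Antitone.intervalIntegrable fun u v huv =>
      measureReal_mono (fun t (ht : v ≤ f t) => huv.trans ht)
  rw [hlc ν, hlc ρ, ← intervalIntegral.integral_sub (hint ν) (hint ρ)]
  have := intervalIntegral.norm_integral_le_of_norm_le_const (a := 0) (b := 1) (C := c)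
    (f := fun u => ν.real {t | u ≤ f t} - ρ.real {t | u ≤ f t}) fun u _ => ?_
  · simpa using this
  rw [Real.norm_eq_abs]
  have hl : IsLowerSet {t | u ≤ f t} := fun a b hab ha => le_trans ha (hf hab)
  have hcl : IsClosed {t | u ≤ f t} := isClosed_le continuous_const hfc
  rcases Set.eq_empty_or_nonempty {t | u ≤ f t} with he | hne
  · simpa [he] using hc
  · by_cases hb : BddAbove {t | u ≤ f t}
    · rw [IsLowerSet.eq_Iic_csSup hl hcl hne hb]
      exact h _
    · have : {t | u ≤ f t} = Set.univ := by
        rw [not_bddAbove_iff] at hb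
        refine Set.eq_univ_of_forall fun t => ?_
        obtain ⟨y, hy, hty⟩ := hb t
        exact hl hty.le hy
      simpa [this] using hc

/-- The approximate indicator is a difference of two antitone functions with values in `[0, 1]`;
each costs `c`. -/
theorem abs_integral_arctanApprox_sub_le {ν ρ : Measure ℝ} [IsProbabilityMeasure ν]
    [IsProbabilityMeasure ρ] {c : ℝ} (h : ∀ x, |ν.real (Set.Iic x) - ρ.real (Set.Iic x)| ≤ c)
    (x : ℝ) (j : ℕ) :
    |∫ t, arctanApprox x j t ∂ν - ∫ t, arctanApprox x j t ∂ρ| ≤ 2 * c := by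
  let f : ℝ → ℝ → ℝ := fun b t =>
    Real.pi⁻¹ * (Real.arctan ((b - t) / (1 / ((j : ℝ) + 1) ^ 2)) + Real.pi / 2)
  have hp := Real.pi_pos
  have hf0 : ∀ b t, 0 ≤ f b t := fun b t => by
    have := Real.neg_pi_div_two_lt_arctan ((b - t) / (1 / ((j : ℝ) + 1) ^ 2))
    exact mul_nonneg (by positivity) (by linarith)
  have hf1 : ∀ b t, f b t ≤ 1 := fun b t => by
    have := Real.arctan_lt_pi_div_two ((b - t) / (1 / ((j : ℝ) + 1) ^ 2))
    simp only [f]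
    rw [inv_mul_le_iff₀ hp]
    linarith
  have hfa : ∀ b, Antitone (f b) := fun b s t hst => by
    simp only [f]
    gcongr
  have hfc : ∀ b, Continuous (f b) := fun b => by fun_prop
  have hfi : ∀ b (μ : Measure ℝ) [IsProbabilityMeasure μ], Integrable (f b) μ := fun b μ _ => by
    refine .of_bound (hfc b).aestronglyMeasurable 1 (.of_forall fun t => ?_)
    rw [Real.norm_of_nonneg (hf0 b t)]
    exact hf1 b t
  have hq : ∀ t, arctanApprox x j t = f (x + 1 / (j + 1)) t - f (-(j + 1)) t := fun t => by
    simp only [arctanApprox, f]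
    ring
  simp only [hq]
  rw [integral_sub (hfi _ ν) (hfi _ ν), integral_sub (hfi _ ρ) (hfi _ ρ)]
  have h1 := abs_le.1 (abs_integral_sub_le_of_antitone h (hfa (x + 1 / (j + 1))) (hfc _)
    (hf0 _) (hf1 _))
  have h2 := abs_le.1 (abs_integral_sub_le_of_antitone h (hfa (-(j + 1))) (hfc _)
    (hf0 _) (hf1 _))
  rw [abs_le]
  constructor <;> linarith [h1.1, h1.2, h2.1, h2.2]

/-- If the distribution functions of `ν k` are within `c` of that of `ρ` and the Stieltjes
transforms of `ν k` converge to that of `μ`, then the distribution functions of `μ` and `ρ` are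
within `2 * c`. -/
theorem abs_measureReal_Iic_sub_le_of_tendsto_stieltjes {ν : ℕ → Measure ℝ} {μ ρ : Measure ℝ}
    [∀ k, IsProbabilityMeasure (ν k)] [IsProbabilityMeasure μ] [IsProbabilityMeasure ρ] {c : ℝ}
    (h : ∀ k x, |(ν k).real (Set.Iic x) - ρ.real (Set.Iic x)| ≤ c)
    (hS : ∀ z : ℂ, z.im ≠ 0 → Tendsto (fun k => stieltjes (ν k) z) atTop (𝓝 (stieltjes μ z)))
    (x : ℝ) : |μ.real (Set.Iic x) - ρ.real (Set.Iic x)| ≤ 2 * c := by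
  refine le_of_tendsto ((tendsto_stieltjesInversion μ x).sub
    (tendsto_stieltjesInversion ρ x)).abs (.of_forall fun j => ?_)
  have hη : (1 / ((j : ℝ) + 1) ^ 2 : ℝ) ≠ 0 := by positivity
  have him : ∀ s : ℝ, ((s : ℂ) + ((1 / (j + 1) ^ 2 : ℝ) : ℂ) * Complex.I).im =
      1 / ((j : ℝ) + 1) ^ 2 := fun s => by
    rw [Complex.add_im, Complex.ofReal_im, zero_add, Complex.im_ofReal_mul, Complex.I_im, mul_one]
  -- With `j` fixed the integration runs over a compact segment at positive height, where the
  -- transforms are uniformly bounded, so the limit in `k` passes inside.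
  have hlim : Tendsto (fun k => stieltjesInversion (stieltjes (ν k)) x j) atTop
      (𝓝 (stieltjesInversion (stieltjes μ) x j)) := by
    refine Tendsto.const_mul _ ?_
    refine intervalIntegral.tendsto_integral_filter_of_dominated_convergence
      (fun _ => |1 / ((j : ℝ) + 1) ^ 2|⁻¹) (.of_forall fun k => ?_)
      (.of_forall fun k => .of_forall fun s _ => ?_) (by simp) (.of_forall fun s _ => ?_)
    · exact (Complex.continuous_im.comp
        (continuous_stieltjes_line (ν k) hη)).aestronglyMeasurable
    · have := norm_stieltjes_le (ν k) (by rw [him s]; exact hη)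
      rw [him s] at this
      exact (Complex.abs_im_le_norm _).trans this
    · exact (Complex.continuous_im.tendsto _).comp (hS _ (by rw [him s]; exact hη))
  refine le_of_tendsto (hlim.sub_const _).abs (.of_forall fun k => ?_)
  rw [stieltjesInversion_stieltjes, stieltjesInversion_stieltjes]
  exact abs_integral_arctanApprox_sub_le (h k) x j

end Stieltjes

end Anderson

namespace Anderson

/-! ### The infinite-volume operator: Green functions and existence of the spectral measure. -/

section InfiniteVolume

open Filter Topology Matrix

variable {d : ℕ}

theorem andersonOp_apply (ω : Config d) (ψ : Site d → ℂ) (x : Site d) :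
    andersonOp ω ψ x =
      ∑ i, ((ψ x - ψ (x + Pi.single i 1)) + (ψ x - ψ (x - Pi.single i 1))) + (ω x : ℂ) * ψ x :=
  rfl

theorem restrictedMatrix_mulVec (ω : Config d) (Λ : Finset (Site d)) (v : Λ → ℂ) (x : Λ) :
    (restrictedMatrix ω Λ *ᵥ v) x = andersonOp ω (embed Λ v) x := by
  rw [restrictedMatrix, LinearMap.toMatrix'_mulVec]
  rfl

theorem embed_restrict (Λ : Finset (Site d)) (ψ : Site d → ℂ) :
    embed Λ (fun x => ψ x) = Set.indicator (Λ : Set (Site d)) ψ := by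
  funext z
  change (if h : z ∈ Λ then ψ z else 0) = _
  by_cases h : z ∈ Λ <;> simp [h]

/-- The sum over the neighbours of a site. -/
def hop (χ : Site d → ℂ) (x : Site d) : ℂ :=
  ∑ i, (χ (x + Pi.single i 1) + χ (x - Pi.single i 1))

theorem andersonOp_eq_neg_hop (ω : Config d) {χ : Site d → ℂ} {x : Site d} (h : χ x = 0) :
    andersonOp ω χ x = - hop χ x := by
  simp only [andersonOp_apply, hop, h, mul_zero, add_zero, ← Finset.sum_neg_distrib]
  exact Finset.sum_congr rfl fun i _ => by ring

theorem norm_hop_sq_le (χ : Site d → ℂ) (x : Site d) :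
    ‖hop χ x‖ ^ 2 ≤
      2 * d * ∑ i, (‖χ (x + Pi.single i 1)‖ ^ 2 + ‖χ (x - Pi.single i 1)‖ ^ 2) := by
  have h1 : ‖hop χ x‖ ≤ ∑ i, (‖χ (x + Pi.single i 1)‖ + ‖χ (x - Pi.single i 1)‖) :=
    (norm_sum_le _ _).trans (Finset.sum_le_sum fun i _ => norm_add_le _ _)
  have h2 : (∑ i, (‖χ (x + Pi.single i 1)‖ + ‖χ (x - Pi.single i 1)‖)) ^ 2 ≤
      d * ∑ i, (‖χ (x + Pi.single i 1)‖ + ‖χ (x - Pi.single i 1)‖) ^ 2 := by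
    have := sq_sum_le_card_mul_sum_sq (s := Finset.univ)
      (f := fun i : Fin d => ‖χ (x + Pi.single i 1)‖ + ‖χ (x - Pi.single i 1)‖)
    rwa [Finset.card_univ, Fintype.card_fin] at this
  calc ‖hop χ x‖ ^ 2 ≤ (∑ i, (‖χ (x + Pi.single i 1)‖ + ‖χ (x - Pi.single i 1)‖)) ^ 2 := by gcongr
    _ ≤ _ := h2
    _ ≤ d * ∑ i, 2 * (‖χ (x + Pi.single i 1)‖ ^ 2 + ‖χ (x - Pi.single i 1)‖ ^ 2) := by
        gcongr with i _
        nlinarith [sq_nonneg (‖χ (x + Pi.single i 1)‖ - ‖χ (x - Pi.single i 1)‖)]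
    _ = _ := by rw [← Finset.mul_sum]; ring

theorem sum_norm_hop_sq_le {χ : Site d → ℂ} (hχ : Summable fun x => ‖χ x‖ ^ 2)
    (Λ : Finset (Site d)) :
    ∑ x ∈ Λ, ‖hop χ x‖ ^ 2 ≤ (2 * d) ^ 2 * ∑' x, ‖χ x‖ ^ 2 := by
  have h : ∀ e : Site d, ∑ x ∈ Λ, ‖χ (x + e)‖ ^ 2 ≤ ∑' x, ‖χ x‖ ^ 2 := fun e => by
    rw [← (Equiv.addRight e).tsum_eq]
    exact ((Equiv.addRight e).summable_iff.2 hχ).sum_le_tsum Λ fun x _ => by positivity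
  calc ∑ x ∈ Λ, ‖hop χ x‖ ^ 2
      ≤ ∑ x ∈ Λ, 2 * d * ∑ i, (‖χ (x + Pi.single i 1)‖ ^ 2 + ‖χ (x - Pi.single i 1)‖ ^ 2) :=
        Finset.sum_le_sum fun x _ => norm_hop_sq_le χ x
    _ = 2 * d * ∑ i : Fin d, (∑ x ∈ Λ, ‖χ (x + Pi.single i 1)‖ ^ 2 +
          ∑ x ∈ Λ, ‖χ (x + -Pi.single i 1)‖ ^ 2) := by
        rw [← Finset.mul_sum, Finset.sum_comm]
        simp only [Finset.sum_add_distrib, sub_eq_add_neg]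
    _ ≤ 2 * d * ∑ _i : Fin d, (∑' x, ‖χ x‖ ^ 2 + ∑' x, ‖χ x‖ ^ 2) := by
        gcongr <;> exact h _
    _ = _ := by
        rw [Finset.sum_const, Finset.card_univ, Fintype.card_fin, nsmul_eq_mul]
        ring

/-- The diagonal Green function of the restricted Anderson operator. -/
noncomputable def green (ω : Config d) (Λ : Finset (Site d)) (z : ℂ) (x : Site d) : ℂ :=
  if h : x ∈ Λ then resolventMatrix (restrictedMatrix ω Λ) z ⟨x, h⟩ ⟨x, h⟩ else 0

theorem norm_resolventMatrix_mulVec_sq_le {ι : Type*} [Fintype ι] [DecidableEq ι]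
    {A : Matrix ι ι ℂ} (hA : A.IsHermitian) {z : ℂ} (hz : z.im ≠ 0) (f : ι → ℂ) :
    ∑ i, ‖(resolventMatrix A z *ᵥ f) i‖ ^ 2 ≤ (z.im ^ 2)⁻¹ * ∑ i, ‖f i‖ ^ 2 := by
  rw [le_inv_mul_iff₀ (by positivity)]
  exact im_sq_mul_sum_sq_le hA (mulVec_resolventMatrix_mulVec hA hz f)

/-- The truncation of `ψ` to `Λ` solves the finite-volume equation up to the source `hop χ`, where
`χ` is the tail of `ψ`. The potential is diagonal and contributes nothing to this source, so its
size is irrelevant; what remains is the resolvent bound and the bound `2d` for hopping. -/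
theorem norm_green_sub_sq_le {ω : Config d} {z : ℂ} (hz : z.im ≠ 0) {ψ : Site d → ℂ}
    (hψ : Summable fun x => ‖ψ x‖ ^ 2) {x₀ : Site d}
    (h : andersonOp ω ψ - z • ψ = Pi.single x₀ 1) {Λ : Finset (Site d)} (h0 : x₀ ∈ Λ) :
    ‖green ω Λ z x₀ - ψ x₀‖ ^ 2 ≤ (z.im ^ 2)⁻¹ * ((2 * d) ^ 2 * ∑' x : {x // x ∉ Λ}, ‖ψ x‖ ^ 2) := by
  set χ : Site d → ℂ := Set.indicator (Λ : Set (Site d))ᶜ ψ with hχ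
  set A := restrictedMatrix ω Λ
  have hA : A.IsHermitian := restrictedMatrix_isHermitian ω Λ
  have hχs : (fun x => ‖χ x‖ ^ 2) =
      Set.indicator (Λ : Set (Site d))ᶜ (fun x => ‖ψ x‖ ^ 2) := by
    funext x
    by_cases hx : x ∈ Λ <;> simp [hχ, hx]
  have hsplit : ψ = embed Λ (fun x => ψ x) + χ := by
    rw [embed_restrict, hχ, Set.indicator_self_add_compl]
  have h1 : A *ᵥ (fun x : Λ => ψ x) - z • (fun x : Λ => ψ x) =
      Pi.single ⟨x₀, h0⟩ 1 + fun x : Λ => hop χ x := by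
    funext x
    have hx : χ x = 0 := by simp [hχ]
    have h2 := congrFun h x
    have h3 := congrFun (map_add (andersonOp ω) (embed Λ (fun x => ψ x)) χ) x
    rw [← hsplit, Pi.add_apply, andersonOp_eq_neg_hop ω hx] at h3
    simp only [Pi.sub_apply, Pi.smul_apply, Pi.add_apply] at h2 ⊢
    have h4 : (Pi.single x₀ 1 : Site d → ℂ) x = (Pi.single ⟨x₀, h0⟩ 1 : Λ → ℂ) x := by
      simp [Pi.single_apply, Subtype.ext_iff]
    rw [restrictedMatrix_mulVec, ← h4, ← h2, h3]
    ring
  have h5 := congrFun (congrArg (fun v => resolventMatrix A z *ᵥ v) h1) ⟨x₀, h0⟩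
  simp only [resolventMatrix_mulVec_sub hA hz, mulVec_add, Pi.add_apply, mulVec_single_one] at h5
  have h6 : green ω Λ z x₀ - ψ x₀ = -(resolventMatrix A z *ᵥ fun x : Λ => hop χ x) ⟨x₀, h0⟩ := by
    rw [h5, green, dif_pos h0]
    simp [A]
  rw [h6, norm_neg]
  calc _ ≤ ∑ i, ‖(resolventMatrix A z *ᵥ fun x : Λ => hop χ x) i‖ ^ 2 :=
        Finset.single_le_sum (f := fun i =>
          ‖(resolventMatrix A z *ᵥ fun x : Λ => hop χ x) i‖ ^ 2)
          (fun i _ => by positivity) (Finset.mem_univ _)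
    _ ≤ (z.im ^ 2)⁻¹ * ∑ x : Λ, ‖hop χ x‖ ^ 2 := norm_resolventMatrix_mulVec_sq_le hA hz _
    _ ≤ (z.im ^ 2)⁻¹ * ((2 * d) ^ 2 * ∑' x, ‖χ x‖ ^ 2) := by
        gcongr
        rw [Finset.sum_coe_sort Λ fun x => ‖hop χ x‖ ^ 2]
        refine sum_norm_hop_sq_le ?_ Λ
        rw [hχs]
        exact hψ.indicator _
    _ = _ := by
        rw [hχs, ← tsum_subtype]
        rfl

theorem tendsto_green {ω : Config d} {z : ℂ} (hz : z.im ≠ 0) {ψ : Site d → ℂ}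
    (hψ : Summable fun x => ‖ψ x‖ ^ 2) {x₀ : Site d}
    (h : andersonOp ω ψ - z • ψ = Pi.single x₀ 1) :
    Tendsto (fun Λ => green ω Λ z x₀) atTop (𝓝 (ψ x₀)) := by
  rw [tendsto_iff_norm_sub_tendsto_zero]
  have h1 : Tendsto (fun Λ : Finset (Site d) =>
      (z.im ^ 2)⁻¹ * ((2 * d) ^ 2 * ∑' x : {x // x ∉ Λ}, ‖ψ x‖ ^ 2)) atTop (𝓝 0) := by
    have := ((tendsto_tsum_compl_atTop_zero fun x => ‖ψ x‖ ^ 2).const_mul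
      (((2 * d) ^ 2 : ℝ))).const_mul (z.im ^ 2)⁻¹
    simpa using this
  have h2 : Tendsto (fun Λ : Finset (Site d) => ‖green ω Λ z x₀ - ψ x₀‖ ^ 2) atTop (𝓝 0) := by
    refine tendsto_of_tendsto_of_tendsto_of_le_of_le' tendsto_const_nhds h1
      (.of_forall fun _ => by positivity) ?_
    filter_upwards [eventually_ge_atTop {x₀}] with Λ hΛ
    exact norm_green_sub_sq_le hz hψ h (hΛ (Finset.mem_singleton_self _))
  have := h2.sqrt
  simpa [Real.sqrt_sq] using this

theorem norm_green_le (ω : Config d) (Λ : Finset (Site d)) {z : ℂ} (hz : z.im ≠ 0) (x : Site d) :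
    ‖green ω Λ z x‖ ≤ |z.im|⁻¹ := by
  by_cases h : x ∈ Λ
  · rw [green, dif_pos h,
      ← integral_matrixSpectralMeasure (restrictedMatrix_isHermitian ω Λ) _ hz]
    exact norm_stieltjes_le _ hz
  · rw [green, dif_neg h]
    simp

theorem summable_norm_andersonOp_single (ω : Config d) (x₀ : Site d) :
    Summable fun x => ‖andersonOp ω (Pi.single x₀ 1) x‖ ^ 2 := by
  refine summable_of_hasFiniteSupport (Set.Finite.subset
    ((Set.finite_singleton x₀).union ((Set.finite_range fun i => x₀ - Pi.single i 1).union
      (Set.finite_range fun i => x₀ + Pi.single i 1))) ?_)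
  intro x hx
  by_contra hcon
  refine hx ?_
  simp only [Set.mem_union, Set.mem_singleton_iff, Set.mem_range, not_or, not_exists] at hcon
  have h0 : (Pi.single x₀ 1 : Site d → ℂ) x = 0 := Pi.single_eq_of_ne hcon.1 _
  have h1 : ∀ i, (Pi.single x₀ 1 : Site d → ℂ) (x + Pi.single i 1) = 0 := fun i =>
    Pi.single_eq_of_ne (fun h => hcon.2.1 i (by rw [← h, add_sub_cancel_right])) _
  have h2 : ∀ i, (Pi.single x₀ 1 : Site d → ℂ) (x - Pi.single i 1) = 0 := fun i =>
    Pi.single_eq_of_ne (fun h => hcon.2.2 i (by rw [← h, sub_add_cancel])) _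
  simp [andersonOp_apply, h0, h1, h2]

/-- The spectral measure at `x₀` of the operator restricted to `Λ` (a point mass if `x₀ ∉ Λ`). -/
noncomputable def localSpectralMeasure (ω : Config d) (x₀ : Site d) (Λ : Finset (Site d)) :
    Measure ℝ :=
  if h : x₀ ∈ Λ then matrixSpectralMeasure (restrictedMatrix_isHermitian ω Λ) ⟨x₀, h⟩
  else Measure.dirac 0

instance (ω : Config d) (x₀ : Site d) (Λ : Finset (Site d)) :
    IsProbabilityMeasure (localSpectralMeasure ω x₀ Λ) := by
  unfold localSpectralMeasure
  split_ifs <;> infer_instance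

/-- `localSpectralMeasure` as an element of the space of probability measures. -/
noncomputable def localSpectralProbability (ω : Config d) (x₀ : Site d) (Λ : Finset (Site d)) :
    ProbabilityMeasure ℝ :=
  ⟨localSpectralMeasure ω x₀ Λ, inferInstance⟩

theorem coe_localSpectralProbability (ω : Config d) (x₀ : Site d) (Λ : Finset (Site d)) :
    (localSpectralProbability ω x₀ Λ : Measure ℝ) = localSpectralMeasure ω x₀ Λ :=
  rfl

theorem lintegral_sq_localSpectralMeasure_le (ω : Config d) (x₀ : Site d)
    (Λ : Finset (Site d)) :
    ∫⁻ t : ℝ, ENNReal.ofReal (t ^ 2) ∂localSpectralMeasure ω x₀ Λ ≤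
      ENNReal.ofReal (∑' x, ‖andersonOp ω (Pi.single x₀ 1) x‖ ^ 2) := by
  by_cases h : x₀ ∈ Λ
  · rw [localSpectralMeasure, dif_pos h]
    rw [lintegral_sq_matrixSpectralMeasure]
    refine ENNReal.ofReal_le_ofReal ?_
    have h1 : ∀ y : Λ, restrictedMatrix ω Λ y ⟨x₀, h⟩ = andersonOp ω (Pi.single x₀ 1) y := by
      intro y
      have h2 := restrictedMatrix_mulVec ω Λ (Pi.single ⟨x₀, h⟩ 1) y
      rw [mulVec_single_one] at h2
      rw [show restrictedMatrix ω Λ y ⟨x₀, h⟩ = (restrictedMatrix ω Λ).col ⟨x₀, h⟩ y from rfl, h2]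
      have h3 : embed Λ (Pi.single ⟨x₀, h⟩ 1) = Pi.single x₀ 1 := by
        funext z
        rw [embed_single, Pi.single_apply]
      rw [h3]
    simp only [h1]
    rw [Finset.sum_coe_sort Λ fun y => ‖andersonOp ω (Pi.single x₀ 1) y‖ ^ 2]
    exact (summable_norm_andersonOp_single ω x₀).sum_le_tsum _ fun _ _ => by positivity
  · rw [localSpectralMeasure, dif_neg h]
    simp

/-- Chebyshev's inequality with a second-moment bound that does not depend on the volume. -/
theorem isTightMeasureSet_localSpectralMeasure (ω : Config d) (x₀ : Site d) :
    IsTightMeasureSet {((μ : ProbabilityMeasure ℝ) : Measure ℝ) |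
      μ ∈ Set.range (localSpectralProbability ω x₀)} := by
  set C := ∑' x, ‖andersonOp ω (Pi.single x₀ 1) x‖ ^ 2
  refine isTightMeasureSet_of_tendsto_measure_norm_gt ?_
  have h1 : Tendsto (fun r : ℝ => ENNReal.ofReal (C / r ^ 2)) atTop (𝓝 0) := by
    have := (tendsto_const_nhds (x := C)).div_atTop (tendsto_pow_atTop (α := ℝ) two_ne_zero)
    simpa using ENNReal.tendsto_ofReal this
  refine tendsto_of_tendsto_of_tendsto_of_le_of_le' tendsto_const_nhds h1
    (.of_forall fun _ => zero_le) ?_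
  filter_upwards [eventually_gt_atTop 0] with r hr
  refine iSup₂_le ?_
  rintro _ ⟨_, ⟨Λ, rfl⟩, rfl⟩
  rw [coe_localSpectralProbability]
  have h2 := mul_meas_ge_le_lintegral (μ := localSpectralMeasure ω x₀ Λ)
    (f := fun t : ℝ => ENNReal.ofReal (t ^ 2)) (by fun_prop) (ENNReal.ofReal (r ^ 2))
  have h3 : localSpectralMeasure ω x₀ Λ {x | r < ‖x‖} ≤
      localSpectralMeasure ω x₀ Λ
        {t | ENNReal.ofReal (r ^ 2) ≤ ENNReal.ofReal (t ^ 2)} := by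
    refine measure_mono fun t (ht : r < ‖t‖) => ENNReal.ofReal_le_ofReal ?_
    rw [← sq_abs t]
    have : r < |t| := ht
    gcongr
  rw [ENNReal.ofReal_div_of_pos (by positivity), ENNReal.le_div_iff_mul_le (by simp [hr.ne'])
    (by simp), mul_comm]
  refine (mul_le_mul_right h3 _).trans (h2.trans ?_)
  exact lintegral_sq_localSpectralMeasure_le ω x₀ Λ

/-- The Anderson operator has a spectral measure at every site. -/
theorem exists_isSpectralMeasure (ω : Config d) (x₀ : Site d) :
    ∃ μ, IsSpectralMeasure ω x₀ μ := by
  -- Along one ultrafilter finer than `atTop`, the measures and, for every `z`, all coordinates of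
  -- the resolvent vectors converge simultaneously, with no diagonal subsequence.
  let U : Ultrafilter (Finset (Site d)) := Ultrafilter.of atTop
  have hU : (U : Filter (Finset (Site d))) ≤ atTop := Ultrafilter.of_le _
  obtain ⟨μ, -, hμ⟩ := (isCompact_closure_of_isTightMeasureSet
    (isTightMeasureSet_localSpectralMeasure ω x₀)).ultrafilter_le_nhds'
      (U.map (localSpectralProbability ω x₀))
      (Ultrafilter.mem_map.2 (univ_mem' fun Λ => subset_closure ⟨Λ, rfl⟩))
  have hμ' : Tendsto (localSpectralProbability ω x₀) U (𝓝 μ) := hμ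
  refine ⟨μ, inferInstance, fun z hz => ?_⟩
  -- Finite-volume resolvent vectors extended by zero; their uniform `ℓ²` bound survives in the
  -- limit `ψ`.
  let φ : Finset (Site d) → Site d → ℂ := fun Λ => if h : x₀ ∈ Λ then
    embed Λ (resolventMatrix (restrictedMatrix ω Λ) z *ᵥ Pi.single ⟨x₀, h⟩ 1) else 0
  have hφ : ∀ Λ (F : Finset (Site d)), ∑ x ∈ F, ‖φ Λ x‖ ^ 2 ≤ (z.im ^ 2)⁻¹ := by
    intro Λ F
    by_cases h : x₀ ∈ Λ
    · set v := resolventMatrix (restrictedMatrix ω Λ) z *ᵥ Pi.single ⟨x₀, h⟩ 1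
      have h1 : ∀ x, ‖φ Λ x‖ ^ 2 = if hx : x ∈ Λ then ‖v ⟨x, hx⟩‖ ^ 2 else 0 := by
        intro x
        simp only [φ, dif_pos h]
        change ‖(if hx : x ∈ Λ then v ⟨x, hx⟩ else 0 : ℂ)‖ ^ 2 = _
        split_ifs <;> simp
      calc ∑ x ∈ F, ‖φ Λ x‖ ^ 2 ≤ ∑ x ∈ F ∪ Λ, ‖φ Λ x‖ ^ 2 :=
            Finset.sum_le_sum_of_subset_of_nonneg Finset.subset_union_left
              fun _ _ _ => by positivity
        _ = ∑ x ∈ Λ, ‖φ Λ x‖ ^ 2 := by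
            refine (Finset.sum_subset Finset.subset_union_right fun x _ hx => ?_).symm
            rw [h1, dif_neg hx]
        _ = ∑ x : Λ, ‖v x‖ ^ 2 := by
            rw [← Finset.sum_coe_sort]
            refine Finset.sum_congr rfl fun x _ => ?_
            rw [h1, dif_pos x.2]
        _ ≤ (z.im ^ 2)⁻¹ * ∑ x, ‖(Pi.single ⟨x₀, h⟩ 1 : Λ → ℂ) x‖ ^ 2 :=
            norm_resolventMatrix_mulVec_sq_le (restrictedMatrix_isHermitian ω Λ) hz _
        _ = _ := by
            rw [Finset.sum_eq_single ⟨x₀, h⟩]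
            · simp
            · intro b _ hb
              simp [Pi.single_eq_of_ne hb]
            · simp
    · simp only [φ, dif_neg h]
      simp [sq_nonneg]
  have hlim : ∀ x, ∃ c, Tendsto (fun Λ => φ Λ x) U (𝓝 c) := by
    intro x
    have hb : ∀ Λ, φ Λ x ∈ Metric.closedBall (0 : ℂ) |z.im|⁻¹ := fun Λ => by
      have := hφ Λ {x}
      rw [Finset.sum_singleton, ← sq_abs z.im, ← inv_pow] at this
      rw [mem_closedBall_zero_iff]
      exact (abs_le_of_sq_le_sq' this (by positivity)).2
    obtain ⟨c, -, hc⟩ := (isCompact_closedBall (0 : ℂ) |z.im|⁻¹).ultrafilter_le_nhds'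
      (U.map fun Λ => φ Λ x) (Ultrafilter.mem_map.2 (univ_mem' hb))
    exact ⟨c, hc⟩
  choose ψ hψ using hlim
  refine ⟨ψ, ?_, ?_, ?_⟩
  · refine memℓp_gen' (C := (z.im ^ 2)⁻¹) fun F => ?_
    simp only [ENNReal.toReal_ofNat, Real.rpow_ofNat]
    exact le_of_tendsto (tendsto_finsetSum _ fun x _ => (hψ x).norm.pow 2)
      (.of_forall fun Λ => hφ Λ F)
  · funext x
    -- At each site the operator sees finitely many coordinates, so pointwise convergence suffices.
    have h1 : Tendsto (fun Λ => (andersonOp ω (φ Λ) - z • φ Λ) x) U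
        (𝓝 ((andersonOp ω ψ - z • ψ) x)) := by
      simp only [Pi.sub_apply, Pi.smul_apply, andersonOp_apply]
      refine Tendsto.sub (Tendsto.add (tendsto_finsetSum _ fun i _ => ?_) ((hψ x).const_mul _))
        ((hψ x).const_smul _)
      exact ((hψ x).sub (hψ _)).add ((hψ x).sub (hψ _))
    refine tendsto_nhds_unique h1 (tendsto_const_nhds.congr' ?_)
    filter_upwards [hU (eventually_ge_atTop {x, x₀})] with Λ hΛ
    have hx : x ∈ Λ := hΛ (by simp)
    have h0 : x₀ ∈ Λ := hΛ (by simp)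
    have h2 := congrFun (mulVec_resolventMatrix_mulVec (restrictedMatrix_isHermitian ω Λ) hz
      (Pi.single ⟨x₀, h0⟩ 1)) ⟨x, hx⟩
    rw [Pi.sub_apply, restrictedMatrix_mulVec] at h2
    simp only [φ, dif_pos h0, Pi.sub_apply]
    have h3 : (Pi.single x₀ 1 : Site d → ℂ) x = (Pi.single ⟨x₀, h0⟩ 1 : Λ → ℂ) ⟨x, hx⟩ := by
      simp [Pi.single_apply]
    rw [h3, ← h2]
    congr 1
    simp [embed, hx]
  · have h1 := (ProbabilityMeasure.tendsto_iff_forall_integral_rclike_tendsto ℂ).1 hμ'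
      (BoundedContinuousFunction.ofNormedAddCommGroup (fun t : ℝ => ((t : ℂ) - z)⁻¹)
        (continuous_inv_sub hz) _ (norm_inv_sub_le hz))
    refine tendsto_nhds_unique (hψ x₀) (h1.congr' ?_)
    filter_upwards [hU (eventually_ge_atTop {x₀})] with Λ hΛ
    have h0 : x₀ ∈ Λ := hΛ (by simp)
    simp only [coe_localSpectralProbability, localSpectralMeasure, dif_pos h0, φ,
      BoundedContinuousFunction.coe_ofNormedAddCommGroup]
    rw [integral_matrixSpectralMeasure _ _ hz, mulVec_single_one]
    simp [embed, h0]

theorem isSpectralMeasure_spectralMeasure (ω : Config d) (x₀ : Site d) :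
    IsSpectralMeasure ω x₀ (spectralMeasure ω x₀) :=
  Classical.epsilon_spec (exists_isSpectralMeasure ω x₀)

instance (ω : Config d) (x₀ : Site d) : IsProbabilityMeasure (spectralMeasure ω x₀) :=
  (isSpectralMeasure_spectralMeasure ω x₀).1

/-- The truncation estimate holds for any square-summable resolvent vector, so the limit identifies
the transform of whichever spectral measure was chosen. -/
theorem tendsto_green_stieltjes (ω : Config d) (x₀ : Site d) {z : ℂ} (hz : z.im ≠ 0) :
    Tendsto (fun Λ => green ω Λ z x₀) atTop (𝓝 (stieltjes (spectralMeasure ω x₀) z)) := by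
  obtain ⟨ψ, h1, h2, h3⟩ := (isSpectralMeasure_spectralMeasure ω x₀).2 z hz
  rw [stieltjes, ← h3]
  refine tendsto_green hz ?_ h2
  simpa using h1.summable (by simp)

end InfiniteVolume

end Anderson

namespace Anderson

/-! ### Mixtures of random probability measures. -/

section Averages

open Filter Topology

variable {α : Type*} [MeasurableSpace α] (P : Measure α) {κ : α → Measure ℝ} [∀ a, IsProbabilityMeasure (κ a)]

theorem isProbabilityMeasure_bind [IsProbabilityMeasure P] (hκ : Measurable κ) : IsProbabilityMeasure (P.bind κ) := by
  constructor
  rw [Measure.bind_apply .univ hκ.aemeasurable]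
  simp

theorem integrable_measureReal [IsProbabilityMeasure P] (hκ : Measurable κ) {s : Set ℝ} (hs : MeasurableSet s) :
    Integrable (fun a => (κ a).real s) P := by
  refine .of_bound ((Measure.measurable_coe hs).comp hκ).ennreal_toReal.aestronglyMeasurable 1
    (.of_forall fun a => ?_)
  rw [Real.norm_of_nonneg measureReal_nonneg]
  exact measureReal_le_one

theorem measureReal_bind (hκ : Measurable κ) {s : Set ℝ} (hs : MeasurableSet s) :
    (P.bind κ).real s = ∫ a, (κ a).real s ∂P := by
  rw [measureReal_def, Measure.bind_apply hs hκ.aemeasurable, ← integral_toReal]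
  · rfl
  · exact ((Measure.measurable_coe hs).comp hκ).aemeasurable
  · exact .of_forall fun a => measure_lt_top _ _

theorem stieltjes_bind [IsProbabilityMeasure P] (hκ : Measurable κ) {z : ℂ} (hz : z.im ≠ 0) :
    stieltjes (P.bind κ) z = ∫ a, stieltjes (κ a) z ∂P := by
  have := isProbabilityMeasure_bind P hκ
  have h := Kernel.integral_comp (η := ⟨κ, hκ⟩) (κ := Kernel.const Unit P) (a := ())
    (f := fun t : ℝ => ((t : ℂ) - z)⁻¹) (by
      rw [Kernel.comp_apply]
      exact integrable_inv_sub (P.bind κ) hz)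
  rw [Kernel.comp_apply] at h
  exact h

end Averages

/-! ### Measurability, the density of states and translation covariance. -/

section FiniteVolume

open Filter Topology Matrix

variable {d : ℕ}

theorem continuous_restrictedMatrix (Λ : Finset (Site d)) :
    Continuous fun ω : Config d => restrictedMatrix ω Λ := by
  refine continuous_matrix fun x y => ?_
  simp only [restrictedMatrix_apply]
  fun_prop

/-- Cramer's rule; the determinant does not vanish for non-real `z`. -/
theorem continuous_resolventMatrix (Λ : Finset (Site d)) {z : ℂ} (hz : z.im ≠ 0) :
    Continuous fun ω : Config d => resolventMatrix (restrictedMatrix ω Λ) z := by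
  have h : Continuous fun ω : Config d => restrictedMatrix ω Λ - z • (1 : Matrix Λ Λ ℂ) :=
    (continuous_restrictedMatrix Λ).sub continuous_const
  simp only [resolventMatrix, Matrix.inv_def, Ring.inverse_eq_inv']
  refine (h.matrix_det.inv₀ fun ω => ?_).smul h.matrix_adjugate
  have := congrArg det (mul_resolventMatrix (restrictedMatrix_isHermitian ω Λ) hz)
  rw [det_mul, det_one] at this
  exact left_ne_zero_of_mul_eq_one this

theorem measurable_green (Λ : Finset (Site d)) {z : ℂ} (hz : z.im ≠ 0) (x : Site d) :
    Measurable fun ω : Config d => green ω Λ z x := by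
  by_cases h : x ∈ Λ
  · simp only [green, dif_pos h]
    exact ((continuous_resolventMatrix Λ hz).matrix_elem _ _).measurable
  · simp only [green, dif_neg h]
    exact measurable_const

theorem integrable_green (P : Measure (Config d)) [IsProbabilityMeasure P]
    (Λ : Finset (Site d)) {z : ℂ} (hz : z.im ≠ 0) (x : Site d) :
    Integrable (fun ω : Config d => green ω Λ z x) P :=
  .of_bound (measurable_green Λ hz x).aestronglyMeasurable _
    (.of_forall fun ω => norm_green_le ω Λ hz x)

/-- The measure is picked by choice separately for each `ω`, yet its Stieltjes transform is a
pointwise limit of measurable finite-volume Green functions, and the transforms determine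
measurability. -/
theorem measurable_spectralMeasure (x : Site d) :
    Measurable fun ω : Config d => spectralMeasure ω x :=
  measurable_of_measurable_stieltjes fun _ hz =>
    measurable_of_tendsto_metrizable' atTop (fun Λ => measurable_green Λ hz x)
      (tendsto_pi_nhds.2 fun ω => tendsto_green_stieltjes ω x hz)

/-- The density of states measure. -/
noncomputable def densityOfStates (P : Measure (Config d)) : Measure ℝ :=
  P.bind fun ω => spectralMeasure ω 0

instance (P : Measure (Config d)) [IsProbabilityMeasure P] :
    IsProbabilityMeasure (densityOfStates P) :=
  isProbabilityMeasure_bind P (measurable_spectralMeasure 0)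

theorem densityOfStates_real_Iic (P : Measure (Config d)) [IsProbabilityMeasure P] (E : ℝ) :
    (densityOfStates P).real (Set.Iic E) = ids P E :=
  measureReal_bind P (measurable_spectralMeasure 0) measurableSet_Iic

/-- The expected diagonal Green function at the origin converges to the Stieltjes transform of the
density of states measure. -/
theorem tendsto_integral_green (P : Measure (Config d)) [IsProbabilityMeasure P] {z : ℂ}
    (hz : z.im ≠ 0) :
    Tendsto (fun Λ => ∫ ω, green ω Λ z 0 ∂P) atTop (𝓝 (stieltjes (densityOfStates P) z)) := by
  rw [densityOfStates, stieltjes_bind P (measurable_spectralMeasure 0) hz]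
  exact tendsto_integral_filter_of_dominated_convergence (fun _ => |z.im|⁻¹)
    (.of_forall fun Λ => (measurable_green Λ hz 0).aestronglyMeasurable)
    (.of_forall fun Λ => .of_forall fun ω => norm_green_le ω Λ hz 0) (integrable_const _)
    (.of_forall fun ω => tendsto_green_stieltjes ω 0 hz)

/-- The normalized eigenvalue distribution of the restricted Anderson operator. -/
noncomputable def eigenvalueMeasure (Λ : Finset (Site d)) (ω : Config d) : Measure ℝ :=
  empiricalMeasure (restrictedMatrix_isHermitian ω Λ)

theorem isProbabilityMeasure_eigenvalueMeasure {Λ : Finset (Site d)} (hΛ : Λ.Nonempty)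
    (ω : Config d) : IsProbabilityMeasure (eigenvalueMeasure Λ ω) := by
  have := hΛ.to_subtype
  unfold eigenvalueMeasure
  infer_instance

theorem evcf_eq_countLE (Λ : Finset (Site d)) (ω : Config d) (x : ℝ) :
    evcf Λ ω x = countLE (restrictedMatrix_isHermitian ω Λ) x :=
  rfl

theorem eigenvalueMeasure_real_Iic (Λ : Finset (Site d)) (ω : Config d) (x : ℝ) :
    (eigenvalueMeasure Λ ω).real (Set.Iic x) = normEvcf Λ ω x := by
  rw [eigenvalueMeasure, empiricalMeasure_real_Iic, normEvcf, evcf_eq_countLE, Fintype.card_coe]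

theorem stieltjes_eigenvalueMeasure (Λ : Finset (Site d)) (ω : Config d) {z : ℂ}
    (hz : z.im ≠ 0) :
    stieltjes (eigenvalueMeasure Λ ω) z = (Λ.card : ℝ)⁻¹ • ∑ x ∈ Λ, green ω Λ z x := by
  rw [stieltjes, eigenvalueMeasure, integral_empiricalMeasure _ hz, Fintype.card_coe,
    ← Finset.sum_coe_sort Λ]
  simp only [green, Finset.coe_mem, dif_pos]

theorem measurable_eigenvalueMeasure {Λ : Finset (Site d)} (hΛ : Λ.Nonempty) :
    Measurable (eigenvalueMeasure Λ) := by
  have := isProbabilityMeasure_eigenvalueMeasure hΛ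
  refine measurable_of_measurable_stieltjes fun z hz => ?_
  simp only [stieltjes_eigenvalueMeasure Λ _ hz]
  have h := Finset.measurable_fun_sum Λ fun x _ => measurable_green Λ hz x
  exact h.const_smul (Λ.card : ℝ)⁻¹

/-- The translate `Λ + w`. -/
def translate (Λ : Finset (Site d)) (w : Site d) : Finset (Site d) :=
  Λ.map (Equiv.addRight w).toEmbedding

theorem add_mem_translate {Λ : Finset (Site d)} {w x : Site d} :
    x + w ∈ translate Λ w ↔ x ∈ Λ := by
  simp [translate]

/-- Translation by `w` as an equivalence of a finite set and its translate. -/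
def translateEquiv (Λ : Finset (Site d)) (w : Site d) : Λ ≃ translate Λ w :=
  (Equiv.addRight w).subtypeEquiv fun _ => add_mem_translate.symm

theorem coe_translateEquiv (Λ : Finset (Site d)) (w : Site d) (x : Λ) :
    (translateEquiv Λ w x : Site d) = x + w :=
  rfl

theorem restrictedMatrix_shift (ω : Config d) (Λ : Finset (Site d)) (w : Site d) :
    (restrictedMatrix ω (translate Λ w)).submatrix (translateEquiv Λ w) (translateEquiv Λ w) =
      restrictedMatrix (shift w ω) Λ := by
  ext x y
  simp only [submatrix_apply, restrictedMatrix_apply, coe_translateEquiv, shift, add_right_comm _ w, add_sub_right_comm _ w, add_left_inj]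

theorem evcf_shift (ω : Config d) (Λ : Finset (Site d)) (w : Site d) (x : ℝ) :
    evcf Λ (shift w ω) x = evcf (translate Λ w) ω x :=
  countLE_submatrix_equiv _ _ (translateEquiv Λ w) (restrictedMatrix_shift ω Λ w) x

theorem eigenvalueMeasure_shift {Λ : Finset (Site d)} (hΛ : Λ.Nonempty) (ω : Config d)
    (w : Site d) :
    eigenvalueMeasure Λ (shift w ω) = eigenvalueMeasure (translate Λ w) ω := by
  have := isProbabilityMeasure_eigenvalueMeasure hΛ
  have := isProbabilityMeasure_eigenvalueMeasure (Λ := translate Λ w) (by simpa [translate])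
  refine Measure.ext_of_Iic _ _ fun x => ?_
  rw [← ENNReal.toReal_eq_toReal_iff' (by simp) (by simp)]
  change (eigenvalueMeasure _ _).real _ = (eigenvalueMeasure _ _).real _
  rw [eigenvalueMeasure_real_Iic, eigenvalueMeasure_real_Iic, normEvcf, normEvcf, evcf_shift]
  simp [translate]

theorem green_shift (ω : Config d) (Λ : Finset (Site d)) (w x : Site d) (z : ℂ) :
    green (shift w ω) Λ z x = green ω (translate Λ w) z (x + w) := by
  by_cases h : x ∈ Λ
  · rw [green, green, dif_pos h, dif_pos (add_mem_translate.2 h), ← restrictedMatrix_shift,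
      resolventMatrix_submatrix_equiv]
    rfl
  · rw [green, green, dif_neg h, dif_neg fun h' => h (add_mem_translate.1 h')]

theorem integral_green_translate {P : Measure (Config d)} (hP : TranslationInvariant P)
    (Λ : Finset (Site d)) (w : Site d) {z : ℂ} (hz : z.im ≠ 0) :
    ∫ ω, green ω (translate Λ w) z w ∂P = ∫ ω, green ω Λ z 0 ∂P := by
  calc ∫ ω, green ω (translate Λ w) z w ∂P = ∫ ω, green (shift w ω) Λ z 0 ∂P := by
        simp only [green_shift, zero_add]
    _ = ∫ ω, green ω Λ z 0 ∂(P.map (shift w)) :=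
        (integral_map (hP w).aemeasurable (measurable_green Λ hz 0).aestronglyMeasurable).symm
    _ = _ := by rw [(hP w).map_eq]

theorem bind_eigenvalueMeasure_translate {P : Measure (Config d)} (hP : TranslationInvariant P)
    {Λ : Finset (Site d)} (hΛ : Λ.Nonempty) (w : Site d) :
    P.bind (eigenvalueMeasure (translate Λ w)) = P.bind (eigenvalueMeasure Λ) := by
  ext s hs
  rw [Measure.bind_apply hs (measurable_eigenvalueMeasure (by simpa [translate])).aemeasurable,
    Measure.bind_apply hs (measurable_eigenvalueMeasure hΛ).aemeasurable]
  simp only [← eigenvalueMeasure_shift hΛ]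
  exact (hP w).lintegral_comp
    ((Measure.measurable_coe hs).comp (measurable_eigenvalueMeasure hΛ))

end FiniteVolume

end Anderson

namespace Anderson

/-! ### Tilings by cubes and comparison with the integrated density of states. -/

section Tiling

open Filter Topology Matrix

variable {d : ℕ}

theorem latticeDist_self (x : Site d) : latticeDist x x = 0 := by
  simp [latticeDist]

theorem latticeDist_add_single (x : Site d) (i : Fin d) :
    latticeDist x (x + Pi.single i 1) = 1 := by
  simp [latticeDist, Pi.single_apply, apply_ite abs]

theorem latticeDist_sub_single (x : Site d) (i : Fin d) :
    latticeDist x (x - Pi.single i 1) = 1 := by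
  simp [latticeDist, Pi.single_apply, apply_ite abs]

theorem restrictedMatrix_eq_zero (ω : Config d) {Λ : Finset (Site d)} {x y : Λ}
    (h : 1 < latticeDist x.1 y.1) : restrictedMatrix ω Λ x y = 0 := by
  have h0 : x.1 ≠ y.1 := fun e => by rw [← e, latticeDist_self] at h; omega
  have h1 : ∀ i, x.1 + Pi.single i 1 ≠ y.1 := fun i e => by
    rw [← e, latticeDist_add_single] at h; omega
  have h2 : ∀ i, x.1 - Pi.single i 1 ≠ y.1 := fun i e => by
    rw [← e, latticeDist_sub_single] at h; omega
  rw [restrictedMatrix_apply]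
  simp [h0, h1, h2]

theorem evcf_le_card (Λ : Finset (Site d)) (ω : Config d) (x : ℝ) : evcf Λ ω x ≤ Λ.card := by
  rw [evcf]
  exact (Finset.card_filter_le _ _).trans_eq (by simp)

/-- The eigenvalue counting function of a finite set compared to the sum of those of mutually
decoupled subsets. -/
theorem sum_evcf_le_and_le {J : Type*} [Fintype J] [DecidableEq J] {Λ₀ : Finset (Site d)}
    {Λ : J → Finset (Site d)} (hsub : ∀ j, Λ j ⊆ Λ₀)
    (hdist : ∀ j j', j ≠ j' → ∀ x ∈ Λ j, ∀ y ∈ Λ j', 1 < latticeDist x y) (ω : Config d) (x : ℝ) :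
    ∑ j, evcf (Λ j) ω x ≤ evcf Λ₀ ω x ∧
      evcf Λ₀ ω x + ∑ j, (Λ j).card ≤ ∑ j, evcf (Λ j) ω x + Λ₀.card := by
  have hf : Function.Injective fun p : (Σ j, Λ j) => (⟨p.2, hsub p.1 p.2.2⟩ : Λ₀) := by
    rintro ⟨j, u⟩ ⟨j', v⟩ huv
    have huv' : u.1 = v.1 := congrArg Subtype.val huv
    by_cases h : j = j'
    · subst h
      rw [Subtype.ext huv']
    · have := hdist j j' h u u.2 v v.2
      rw [huv', latticeDist_self] at this
      omega
  have := sum_countLE_le_and_le (restrictedMatrix_isHermitian ω Λ₀)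
    (fun j => restrictedMatrix_isHermitian ω (Λ j)) hf (by
      ext ⟨j, u⟩ ⟨j', v⟩
      by_cases h : j = j'
      · subst h
        rw [blockDiagonal'_apply_eq, submatrix_apply, restrictedMatrix_apply,
          restrictedMatrix_apply]
      · rw [blockDiagonal'_apply_ne _ _ _ h, submatrix_apply]
        exact restrictedMatrix_eq_zero ω (hdist j j' h u u.2 v v.2)) x
  simp only [Fintype.card_coe] at this
  exact this

/-- `T / V` lies between `S / V` and `S / V + (1 - W / V)`, and so does `S / W`, since `S / W - S /
V = (S / W) (1 - W / V)` with `S / W ≤ 1`. -/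
theorem abs_div_sub_div_le {S T V W : ℝ} (hS : 0 ≤ S) (hV : 0 < V) (hW : 0 < W) (h1 : S ≤ T)
    (h2 : T + W ≤ S + V) (h3 : S ≤ W) : |T / V - S / W| ≤ 1 - W / V := by
  have b1 : S / W ≤ 1 := div_le_one_of_le₀ h3 hW.le
  have hW1 : W / V ≤ 1 := div_le_one_of_le₀ (by linarith) hV.le
  have e2 : S / V = S / W * (W / V) := by field_simp
  have r4 : S / V ≤ T / V := by gcongr
  have r5 : T / V ≤ S / V + 1 - W / V := by
    rw [← div_self hV.ne', ← add_div, ← sub_div]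
    gcongr
    linarith
  have r6 : S / V ≤ S / W := by
    gcongr
    linarith
  have r7 : S / W * (1 - W / V) ≤ 1 - W / V := mul_le_of_le_one_left (by linarith) b1
  rw [abs_le]
  constructor <;> linarith

theorem abs_normEvcf_sub_average_le {J : Type*} [Fintype J] [DecidableEq J] [Nonempty J]
    {Λ₀ : Finset (Site d)} {Λ : J → Finset (Site d)} (hsub : ∀ j, Λ j ⊆ Λ₀)
    (hdist : ∀ j j', j ≠ j' → ∀ x ∈ Λ j, ∀ y ∈ Λ j', 1 < latticeDist x y) {q : ℕ} (hq : 0 < q)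
    (hcard : ∀ j, (Λ j).card = q) (ω : Config d) (x : ℝ) :
    |normEvcf Λ₀ ω x - (Fintype.card J : ℝ)⁻¹ * ∑ j, normEvcf (Λ j) ω x| ≤
      1 - (Fintype.card J * q : ℝ) / Λ₀.card := by
  obtain ⟨h1, h2⟩ := sum_evcf_le_and_le hsub hdist ω x
  have h3 : ∑ j, evcf (Λ j) ω x ≤ Fintype.card J * q := by
    refine (Finset.sum_le_sum fun j _ => evcf_le_card (Λ j) ω x).trans_eq ?_
    simp [hcard]
  have h4 : (0 : ℝ) < Fintype.card J * q := by
    have := Fintype.card_pos (α := J)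
    positivity
  simp only [hcard, Finset.sum_const, Finset.card_univ, smul_eq_mul] at h2
  have h5 : 0 < Λ₀.card := by
    obtain ⟨j⟩ := ‹Nonempty J›
    exact (hq.trans_eq (hcard j).symm).trans_le (Finset.card_le_card (hsub j))
  have e1 : (Fintype.card J : ℝ)⁻¹ * ∑ j, normEvcf (Λ j) ω x =
      ((∑ j, evcf (Λ j) ω x : ℕ) : ℝ) / (Fintype.card J * q) := by
    simp only [normEvcf, hcard]
    rw [← Finset.sum_div, ← div_eq_inv_mul, div_div, mul_comm (q : ℝ), Nat.cast_sum]
  rw [e1, normEvcf]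
  exact abs_div_sub_div_le (by positivity) (by exact_mod_cast h5) h4 (by exact_mod_cast h1)
    (by exact_mod_cast h2) (by exact_mod_cast h3)

theorem mem_cube {a : Site d} {n : ℕ} {x : Site d} :
    x ∈ cube a n ↔ ∀ i, a i ≤ x i ∧ x i < a i + n := by
  simp [cube, Fintype.mem_piFinset]

theorem card_cube (a : Site d) (n : ℕ) : (cube a n).card = n ^ d := by
  simp [cube, Fintype.card_piFinset]

theorem cube_nonempty (a : Site d) {n : ℕ} (hn : 0 < n) : (cube a n).Nonempty :=
  ⟨a, mem_cube.2 fun _ => ⟨le_rfl, by omega⟩⟩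

theorem translate_cube (a w : Site d) (n : ℕ) : translate (cube a n) w = cube (a + w) n := by
  ext x
  rw [← sub_add_cancel x w, add_mem_translate, mem_cube, mem_cube]
  refine forall_congr' fun i => ?_
  simp only [Pi.sub_apply, Pi.add_apply]
  constructor <;> intro h <;> constructor <;> omega

/-- The lower corner of the block with index `j` in the tiling by cubes of side length `m`. -/
def corner (a : Site d) (m : ℕ) {k : ℕ} (j : Fin d → Fin k) : Site d :=
  a + fun i => (m * (j i : ℕ) : ℤ)

theorem cube_corner_subset (a : Site d) {ℓ g k n : ℕ} (hn : k * (ℓ + g) ≤ n)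
    (j : Fin d → Fin k) : cube (corner a (ℓ + g) j) ℓ ⊆ cube a n := by
  intro x hx
  rw [mem_cube] at hx ⊢
  intro i
  have h := hx i
  simp only [corner, Pi.add_apply] at h
  have h1 : (ℓ + g) * ((j i : ℕ) + 1) ≤ n := by
    refine le_trans ?_ hn
    rw [mul_comm]
    exact Nat.mul_le_mul_right _ (j i).2
  have h2 : ((ℓ + g : ℕ) : ℤ) * (j i : ℕ) + (ℓ + g : ℕ) ≤ n := by
    rw [mul_add, mul_one] at h1
    exact_mod_cast h1
  have h3 : (0 : ℤ) ≤ ((ℓ + g : ℕ) : ℤ) * (j i : ℕ) := by positivity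
  push_cast at h h2 h3
  constructor <;> omega

theorem lt_latticeDist_of_mem_cube_corner (a : Site d) {ℓ g k : ℕ} {j j' : Fin d → Fin k}
    (hj : j ≠ j') {x y : Site d} (hx : x ∈ cube (corner a (ℓ + g) j) ℓ)
    (hy : y ∈ cube (corner a (ℓ + g) j') ℓ) : (g : ℤ) < latticeDist x y := by
  obtain ⟨i, hi⟩ := Function.ne_iff.1 hj
  have h0 : |x i - y i| ≤ latticeDist x y :=
    Finset.single_le_sum (f := fun i => |x i - y i|) (fun _ _ => abs_nonneg _) (Finset.mem_univ i)
  refine lt_of_lt_of_le ?_ h0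
  have hx' := mem_cube.1 hx i
  have hy' := mem_cube.1 hy i
  simp only [corner, Pi.add_apply] at hx' hy'
  have key : ∀ u v : ℕ, u < v → (((ℓ + g : ℕ) : ℤ)) * u + (ℓ + g : ℕ) ≤ ((ℓ + g : ℕ) : ℤ) * v := by
    intro u v huv
    have : (ℓ + g) * (u + 1) ≤ (ℓ + g) * v := Nat.mul_le_mul_left _ huv
    rw [mul_add, mul_one] at this
    exact_mod_cast this
  have hne : (j i : ℕ) ≠ j' i := fun h => hi (Fin.ext h)
  rcases lt_or_gt_of_ne hne with h | h
  · have := key _ _ h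
    push_cast at this hx' hy'
    rw [abs_sub_comm]
    exact lt_of_lt_of_le (by omega) (le_abs_self _)
  · have := key _ _ h
    push_cast at this hx' hy'
    exact lt_of_lt_of_le (by omega) (le_abs_self _)

theorem abs_normEvcf_cube_sub_average_le (a : Site d) {ℓ g k n : ℕ} (hℓ : 0 < ℓ) (hg : 0 < g)
    (hk : 0 < k) (hn : k * (ℓ + g) ≤ n) (ω : Config d) (x : ℝ) :
    |normEvcf (cube a n) ω x -
        ((k : ℝ) ^ d)⁻¹ * ∑ j : Fin d → Fin k, normEvcf (cube (corner a (ℓ + g) j) ℓ) ω x| ≤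
      1 - (k * ℓ / n : ℝ) ^ d := by
  have : Nonempty (Fin k) := ⟨⟨0, hk⟩⟩
  have h := abs_normEvcf_sub_average_le (J := Fin d → Fin k)
    (cube_corner_subset a hn) (fun j j' hj x hx y hy => lt_of_le_of_lt (by exact_mod_cast hg)
      (lt_latticeDist_of_mem_cube_corner a hj hx hy)) (pow_pos hℓ d)
    (fun j => card_cube _ _) ω x
  rw [card_cube] at h
  simpa [div_pow, mul_pow] using h

theorem integrable_normEvcf (P : Measure (Config d)) [IsProbabilityMeasure P]
    {Λ : Finset (Site d)} (hΛ : Λ.Nonempty) (x : ℝ) : Integrable (fun ω => normEvcf Λ ω x) P := by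
  have := isProbabilityMeasure_eigenvalueMeasure hΛ
  simp only [← eigenvalueMeasure_real_Iic]
  exact integrable_measureReal P (measurable_eigenvalueMeasure hΛ) measurableSet_Iic

theorem bind_eigenvalueMeasure_real_Iic (P : Measure (Config d)) {Λ : Finset (Site d)}
    (hΛ : Λ.Nonempty) (x : ℝ) :
    (P.bind (eigenvalueMeasure Λ)).real (Set.Iic x) = ∫ ω, normEvcf Λ ω x ∂P := by
  have := isProbabilityMeasure_eigenvalueMeasure hΛ
  rw [measureReal_bind P (measurable_eigenvalueMeasure hΛ) measurableSet_Iic]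
  simp only [eigenvalueMeasure_real_Iic]

theorem bind_eigenvalueMeasure_cube {P : Measure (Config d)} (hP : TranslationInvariant P)
    (a : Site d) {n : ℕ} (hn : 0 < n) :
    P.bind (eigenvalueMeasure (cube a n)) = P.bind (eigenvalueMeasure (cube 0 n)) := by
  rw [← bind_eigenvalueMeasure_translate hP (cube_nonempty 0 hn) a, translate_cube, zero_add]

/-- The tiling estimate in expectation: by translation invariance all blocks share one mean, so the
average collapses. -/
theorem abs_bind_eigenvalueMeasure_cube_sub_le {P : Measure (Config d)} [IsProbabilityMeasure P]
    (hP : TranslationInvariant P) {ℓ g k n : ℕ} (hℓ : 0 < ℓ) (hg : 0 < g)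
    (hk : 0 < k) (hn : k * (ℓ + g) ≤ n) (x : ℝ) :
    |(P.bind (eigenvalueMeasure (cube 0 n))).real (Set.Iic x) -
        (P.bind (eigenvalueMeasure (cube 0 ℓ))).real (Set.Iic x)| ≤ 1 - (k * ℓ / n : ℝ) ^ d := by
  have hn0 : 0 < n := lt_of_lt_of_le (by positivity) hn
  have hint : ∀ j : Fin d → Fin k,
      Integrable (fun ω => normEvcf (cube (corner 0 (ℓ + g) j) ℓ) ω x) P := fun j =>
    integrable_normEvcf P (cube_nonempty _ hℓ) x
  have h1 : (P.bind (eigenvalueMeasure (cube 0 ℓ))).real (Set.Iic x) =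
      ∫ ω, ((k : ℝ) ^ d)⁻¹ *
        ∑ j : Fin d → Fin k, normEvcf (cube (corner 0 (ℓ + g) j) ℓ) ω x ∂P := by
    rw [integral_const_mul, integral_finsetSum _ fun j _ => hint j]
    have h2 : ∀ j : Fin d → Fin k, ∫ ω, normEvcf (cube (corner 0 (ℓ + g) j) ℓ) ω x ∂P =
        (P.bind (eigenvalueMeasure (cube 0 ℓ))).real (Set.Iic x) := fun j => by
      rw [← bind_eigenvalueMeasure_real_Iic P (cube_nonempty _ hℓ), bind_eigenvalueMeasure_cube hP _ hℓ]
    simp only [h2, Finset.sum_const, Finset.card_univ, Fintype.card_fun, Fintype.card_fin,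
      nsmul_eq_mul]
    push_cast
    rw [inv_mul_cancel_left₀ (by positivity)]
  rw [h1, bind_eigenvalueMeasure_real_Iic P (cube_nonempty _ hn0), ← integral_sub
    (integrable_normEvcf P (cube_nonempty _ hn0) x)
    ((integrable_finsetSum _ fun j _ => hint j).const_mul _)]
  have := norm_integral_le_of_norm_le_const (μ := P) (C := 1 - (k * ℓ / n : ℝ) ^ d)
    (f := fun ω => normEvcf (cube 0 n) ω x - ((k : ℝ) ^ d)⁻¹ *
      ∑ j : Fin d → Fin k, normEvcf (cube (corner 0 (ℓ + g) j) ℓ) ω x)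
    (.of_forall fun ω => abs_normEvcf_cube_sub_average_le 0 hℓ hg hk hn ω x)
  simpa using this

theorem tendsto_natCast_sub_div (c : ℕ) :
    Tendsto (fun N : ℕ => ((N - c : ℕ) : ℝ) / N) atTop (𝓝 1) := by
  have h : Tendsto (fun N : ℕ => 1 - (c : ℝ) / N) atTop (𝓝 (1 - 0)) :=
    tendsto_const_nhds.sub (tendsto_const_div_atTop_nhds_zero_nat _)
  rw [sub_zero] at h
  refine h.congr' ?_
  filter_upwards [eventually_ge_atTop (c + 1)] with N hN
  have : (0 : ℝ) < N := by exact_mod_cast (by omega : 0 < N)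
  rw [Nat.cast_sub (by omega)]
  field_simp

/-- Seen from a site at depth `R` inside a cube, the cube covers `Λ`. When `N ≤ 2 * R` the truncated
side length is zero and there is no such site. -/
theorem exists_cube_subset (Λ : Finset (Site d)) :
    ∃ R : ℕ, ∀ (N : ℕ) (x : Site d), x ∈ cube (fun _ => (R : ℤ)) (N - 2 * R) →
      Λ ⊆ cube (-x) N := by
  refine ⟨∑ y ∈ Λ, ∑ i, (y i).natAbs + 1, fun N x hx y hy => ?_⟩
  rw [mem_cube] at hx ⊢
  intro i
  have h1 : (y i).natAbs ≤ ∑ y ∈ Λ, ∑ i, (y i).natAbs :=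
    (Finset.single_le_sum (f := fun i => (y i).natAbs) (fun _ _ => Nat.zero_le _)
      (Finset.mem_univ i)).trans
      (Finset.single_le_sum (f := fun y : Site d => ∑ i, (y i).natAbs)
        (fun _ _ => Nat.zero_le _) hy)
  have h2 := hx i
  simp only [Pi.neg_apply] at h2 ⊢
  omega

/-- The Stieltjes transforms of the averaged eigenvalue distributions of large cubes converge to
that of the density of states measure. -/
theorem tendsto_stieltjes_bind_eigenvalueMeasure_cube {P : Measure (Config d)}
    [IsProbabilityMeasure P] (hP : TranslationInvariant P) {z : ℂ} (hz : z.im ≠ 0) :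
    Tendsto (fun N : ℕ => stieltjes (P.bind (eigenvalueMeasure (cube 0 N))) z) atTop
      (𝓝 (stieltjes (densityOfStates P) z)) := by
  set S := stieltjes (densityOfStates P) z
  set B : ℝ := |z.im|⁻¹ + |z.im|⁻¹
  have hB : 0 ≤ B := by positivity
  rw [Metric.tendsto_atTop']
  intro ε hε
  obtain ⟨Λ, hΛ⟩ := (Metric.tendsto_atTop.1 (tendsto_integral_green P hz)) (ε / 2) (by positivity)
  obtain ⟨R, hR⟩ := exists_cube_subset Λ
  have hlim : Tendsto (fun N : ℕ => ε / 2 + B * (1 - (((N - 2 * R : ℕ) : ℝ) / N) ^ d)) atTop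
      (𝓝 (ε / 2)) := by
    have := (((tendsto_natCast_sub_div (2 * R)).pow d).const_sub 1).const_mul B
    simpa using this.const_add (ε / 2)
  obtain ⟨N₀, hN₀⟩ := eventually_atTop.1
    ((hlim.eventually (gt_mem_nhds (half_lt_self hε))).and (eventually_gt_atTop 0))
  refine ⟨N₀, fun N hN => ?_⟩
  obtain ⟨hN1, hN2⟩ := hN₀ N hN.le
  refine lt_of_le_of_lt ?_ hN1
  have hne := cube_nonempty (0 : Site d) hN2
  have := isProbabilityMeasure_eigenvalueMeasure hne
  -- The transform is the mean of the diagonal Green functions; in expectation each is recentred at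
  -- the origin, at the price of moving the cube.
  have h1 : stieltjes (P.bind (eigenvalueMeasure (cube 0 N))) z =
      ((N : ℝ) ^ d)⁻¹ • ∑ x ∈ cube 0 N, ∫ ω, green ω (cube (-x) N) z 0 ∂P := by
    rw [stieltjes_bind P (measurable_eigenvalueMeasure hne) hz]
    simp only [stieltjes_eigenvalueMeasure _ _ hz]
    rw [integral_smul, integral_finsetSum _ fun x _ => integrable_green P _ hz x, card_cube,
      Nat.cast_pow]
    congr 1
    refine Finset.sum_congr rfl fun x _ => ?_
    rw [← integral_green_translate hP _ x hz, translate_cube, neg_add_cancel]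
  have h2 : S = ((N : ℝ) ^ d)⁻¹ • ∑ _x ∈ cube (0 : Site d) N, S := by
    rw [Finset.sum_const, card_cube, ← Nat.cast_smul_eq_nsmul ℝ, Nat.cast_pow,
      inv_smul_smul₀ (by positivity)]
  -- Deep sites are within `ε / 2` of the limit; the others are bounded trivially by `B`, and their
  -- proportion tends to zero.
  have hbound : ∀ x ∈ cube (0 : Site d) N, ‖(∫ ω, green ω (cube (-x) N) z 0 ∂P) - S‖ ≤
      ε / 2 + B * (1 - if x ∈ cube (fun _ => (R : ℤ)) (N - 2 * R) then 1 else 0) := by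
    intro x _
    split_ifs with hx
    · have := hΛ _ (hR N x hx)
      rw [dist_eq_norm] at this
      linarith
    · have e1 : ‖∫ ω, green ω (cube (-x) N) z 0 ∂P‖ ≤ |z.im|⁻¹ := by
        simpa using norm_integral_le_of_norm_le_const (μ := P)
          (.of_forall fun ω => norm_green_le ω (cube (-x) N) hz 0)
      have e2 : ‖S‖ ≤ |z.im|⁻¹ := norm_stieltjes_le _ hz
      have := norm_sub_le (∫ ω, green ω (cube (-x) N) z 0 ∂P) S
      linarith
  have hinner : (cube (fun _ => (R : ℤ)) (N - 2 * R) : Finset (Site d)) ⊆ cube 0 N := by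
    intro x hx
    rw [mem_cube] at hx ⊢
    intro i
    have := hx i
    simp only [Pi.zero_apply]
    omega
  have hcard : ∑ x ∈ cube (0 : Site d) N,
      (if x ∈ cube (fun _ => (R : ℤ)) (N - 2 * R) then 1 else 0 : ℝ) =
      ((N - 2 * R : ℕ) : ℝ) ^ d := by
    rw [Finset.sum_ite_mem, Finset.inter_eq_right.2 hinner, Finset.sum_const, card_cube]
    simp
  have hNd : (0 : ℝ) < (N : ℝ) ^ d := by positivity
  rw [dist_eq_norm, h1, h2, ← smul_sub, ← Finset.sum_sub_distrib, norm_smul,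
    Real.norm_of_nonneg (by positivity), inv_mul_le_iff₀ hNd]
  refine (norm_sum_le_of_le _ hbound).trans_eq ?_
  rw [Finset.sum_add_distrib, ← Finset.mul_sum, Finset.sum_sub_distrib, hcard]
  simp only [Finset.sum_const, card_cube, nsmul_eq_mul, div_pow]
  push_cast
  field_simp

/-- The averaged normalized eigenvalue counting function of a cube is close to the integrated
density of states. -/
theorem abs_ids_sub_le {P : Measure (Config d)} [IsProbabilityMeasure P]
    (hP : TranslationInvariant P) {ℓ : ℕ} (hℓ : 0 < ℓ) (x : ℝ) :
    |ids P x - (P.bind (eigenvalueMeasure (cube 0 ℓ))).real (Set.Iic x)| ≤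
      2 * (1 - (ℓ / (ℓ + 1) : ℝ) ^ d) := by
  have hp : ∀ n : ℕ, 0 < n → IsProbabilityMeasure (P.bind (eigenvalueMeasure (cube (d := d) 0 n))) :=
    fun n hn => by
      have := isProbabilityMeasure_eigenvalueMeasure (cube_nonempty (0 : Site d) hn)
      exact isProbabilityMeasure_bind P (measurable_eigenvalueMeasure (cube_nonempty 0 hn))
  have := hp ℓ hℓ
  have := fun k : ℕ => hp ((k + 1) * (ℓ + 1)) (by positivity)
  rw [← densityOfStates_real_Iic]
  -- Cubes of side `(k + 1) * (ℓ + 1)` are tiled exactly with corridor width one, so the tiling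
  -- error is the same for all `k`.
  refine abs_measureReal_Iic_sub_le_of_tendsto_stieltjes
    (ν := fun k => P.bind (eigenvalueMeasure (cube 0 ((k + 1) * (ℓ + 1))))) (fun k x => ?_)
    (fun z hz => ?_) x
  · have h := abs_bind_eigenvalueMeasure_cube_sub_le hP hℓ one_pos (Nat.succ_pos k) le_rfl x
    convert h using 3
    push_cast
    field_simp
  · refine (tendsto_stieltjes_bind_eigenvalueMeasure_cube hP hz).comp ?_
    exact tendsto_atTop_mono (fun k => show k ≤ _ by nlinarith) tendsto_id

end Tiling

end Anderson

namespace Anderson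

/-! ### A quantitative Glivenko–Cantelli theorem. -/

section GlivenkoCantelli

open Filter Topology

/-- Take the infimum of the points where the distribution function reaches `p`: right continuity
gives the first bound and the left limit the second. Atoms force the two-sided form. -/
theorem exists_quantile (ρ : Measure ℝ) [IsProbabilityMeasure ρ] {p : ℝ} (h0 : 0 < p)
    (h1 : p < 1) : ∃ t, p ≤ ρ.real (Set.Iic t) ∧ ρ.real (Set.Iio t) ≤ p := by
  let A : Set ℝ := {x | p ≤ cdf ρ x}
  have hne : A.Nonempty := by
    obtain ⟨x, hx⟩ := ((tendsto_cdf_atTop ρ).eventually (lt_mem_nhds h1)).exists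
    exact ⟨x, hx.le⟩
  have hb : BddBelow A := by
    obtain ⟨x, hx⟩ := ((tendsto_cdf_atBot ρ).eventually (gt_mem_nhds h0)).exists
    exact ⟨x, fun y hy => le_of_not_gt fun hyx =>
      absurd (hy.trans (monotone_cdf ρ hyx.le)) (not_le.2 hx)⟩
  refine ⟨sInf A, ?_, ?_⟩
  · rw [← cdf_eq_real]
    have h2 : Tendsto (cdf ρ) (𝓝[>] sInf A) (𝓝 (cdf ρ (sInf A))) :=
      ((cdf ρ).right_continuous _).mono_left (nhdsWithin_mono _ Set.Ioi_subset_Ici_self)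
    refine ge_of_tendsto h2 ?_
    filter_upwards [self_mem_nhdsWithin] with y hy
    obtain ⟨x, hx, hxy⟩ := exists_lt_of_csInf_lt hne hy
    exact le_trans hx (monotone_cdf ρ hxy.le)
  · have h2 : ρ (Set.Iio (sInf A)) = ENNReal.ofReal (Function.leftLim (cdf ρ) (sInf A) - 0) := by
      conv_lhs => rw [← measure_cdf ρ]
      exact (cdf ρ).measure_Iio (tendsto_cdf_atBot ρ) _
    have h3 : Function.leftLim (cdf ρ) (sInf A) ≤ p := by
      refine le_of_tendsto ((monotone_cdf ρ).tendsto_leftLim _) ?_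
      filter_upwards [self_mem_nhdsWithin] with y hy
      exact le_of_not_ge fun h => notMem_of_lt_csInf hy hb h
    rw [measureReal_def, h2, sub_zero]
    exact ENNReal.toReal_le_of_le_ofReal h0.le (ENNReal.ofReal_le_ofReal h3)

/-- A distribution function is uniformly controlled by its values and left limits at `N` points. -/
theorem exists_finset_control (ρ : Measure ℝ) [IsProbabilityMeasure ρ] {N : ℕ} (hN : 0 < N) :
    ∃ T : Finset ℝ, T.card ≤ N ∧ ∀ (a b : ℝ → ℝ) (ε : ℝ), 0 ≤ ε → Monotone a →
      (∀ x t, x < t → a x ≤ b t) → (∀ x, 0 ≤ a x) → (∀ x, a x ≤ 1) →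
      (∀ t ∈ T, |a t - ρ.real (Set.Iic t)| ≤ ε ∧ |b t - ρ.real (Set.Iio t)| ≤ ε) →
      ∀ x, |a x - ρ.real (Set.Iic x)| ≤ ε + 1 / N := by
  have hN' : (0 : ℝ) < N := by exact_mod_cast hN
  -- Only the indices `0 < i < N` carry a quantile; elsewhere `t` is the default `0`, so including
  -- index `0` in the finite set is harmless.
  have hq : ∀ i : ℕ, ∃ t, 0 < i → i < N → (i / N : ℝ) ≤ ρ.real (Set.Iic t) ∧
      ρ.real (Set.Iio t) ≤ (i / N : ℝ) := by
    intro i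
    by_cases hi : 0 < i ∧ i < N
    · obtain ⟨t, ht⟩ := exists_quantile ρ (p := i / N)
        (div_pos (by exact_mod_cast hi.1) hN') ((div_lt_one hN').2 (by exact_mod_cast hi.2))
      exact ⟨t, fun _ _ => ht⟩
    · exact ⟨0, fun h1 h2 => absurd ⟨h1, h2⟩ hi⟩
  choose t ht using hq
  refine ⟨(Finset.range N).image t, Finset.card_image_le.trans_eq (by simp), ?_⟩
  intro a b ε hε ha hab ha0 ha1 hT x
  have hT' : ∀ i, i < N → |a (t i) - ρ.real (Set.Iic (t i))| ≤ ε ∧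
      |b (t i) - ρ.real (Set.Iio (t i))| ≤ ε := fun i hi =>
    hT _ (Finset.mem_image_of_mem t (Finset.mem_range.2 hi))
  set F := ρ.real (Set.Iic x) with hF
  have hF0 : 0 ≤ F := measureReal_nonneg
  have hF1 : F ≤ 1 := measureReal_le_one
  have hinv : 0 ≤ 1 / (N : ℝ) := by positivity
  rw [abs_le]
  constructor
  · by_cases h : F ≤ 1 / N
    · linarith [ha0 x]
    -- The last quantile level strictly below `F`; its point lies at or left of `x`, so monotonicity
    -- bounds `a x` from below.
    · obtain ⟨i, hi⟩ : ∃ i : ℕ, i + 1 = ⌈N * F⌉₊ := by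
        refine ⟨⌈N * F⌉₊ - 1, Nat.sub_add_cancel (Nat.one_le_ceil_iff.2 ?_)⟩
        have := lt_trans (by positivity) (not_le.1 h)
        positivity
      have h1 : (i : ℝ) < N * F := Nat.lt_ceil.1 (by omega)
      have h2 : N * F ≤ i + 1 := by
        have := Nat.le_ceil (N * F)
        rw [← hi] at this
        exact_mod_cast this
      have hi0 : 0 < i := by
        rcases Nat.eq_zero_or_pos i with h0 | h0
        · rw [h0] at h2
          exact absurd ((le_div_iff₀ hN').2 (by push_cast at h2; linarith)) h
        · exact h0
      have hiN : i < N := by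
        have : (i : ℝ) < N := h1.trans_le (mul_le_of_le_one_right hN'.le hF1)
        exact_mod_cast this
      have htx : t i ≤ x := by
        by_contra hcon
        have h3 : F ≤ ρ.real (Set.Iio (t i)) :=
          measureReal_mono fun y (hy : y ≤ x) => lt_of_le_of_lt hy (not_le.1 hcon)
        have h4 : F ≤ i / N := h3.trans (ht i hi0 hiN).2
        rw [le_div_iff₀ hN'] at h4
        linarith
      have h3 := (abs_le.1 (hT' i hiN).1).1
      have h4 := ha htx
      have h5 := (ht i hi0 hiN).1
      have h6 : F ≤ i / N + 1 / N := by
        rw [← add_div, le_div_iff₀ hN']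
        linarith
      linarith
  -- The first level strictly above `F`; its point lies strictly right of `x`, so the left limit `b`
  -- bounds `a x` and an atom at that point does no harm.
  · set i := ⌊N * F⌋₊ + 1 with hi
    have h1 : N * F < i := by
      rw [hi]
      push_cast
      exact Nat.lt_floor_add_one _
    have h2 : (i : ℝ) ≤ N * F + 1 := by
      rw [hi]
      push_cast
      linarith [Nat.floor_le (mul_nonneg hN'.le hF0)]
    have h2' : (i / N : ℝ) ≤ F + 1 / N := by
      rw [div_le_iff₀ hN', add_mul, one_div_mul_cancel hN'.ne']
      linarith
    by_cases hiN : i < N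
    · have hxt : x < t i := by
        by_contra hcon
        have h3 : ρ.real (Set.Iic (t i)) ≤ F :=
          measureReal_mono (Set.Iic_subset_Iic.2 (not_lt.1 hcon))
        have h4 := (ht i (by omega) hiN).1.trans h3
        rw [div_le_iff₀ hN'] at h4
        linarith
      have h3 := (abs_le.1 (hT' i hiN).2).2
      have h4 := hab x _ hxt
      have h5 := (ht i (by omega) hiN).2
      linarith
    · have : (1 : ℝ) ≤ i / N := (one_le_div hN').2 (by exact_mod_cast not_lt.1 hiN)
      linarith [ha1 x]

variable {Ω : Type*} [MeasurableSpace Ω] {P : Measure Ω} [IsProbabilityMeasure P]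
  {J : Type*} [Fintype J]

/-- The average of the values of a family of measures on a set. -/
noncomputable def averageReal (G : J → Ω → Measure ℝ) (s : Set ℝ) (ω : Ω) : ℝ :=
  (Fintype.card J : ℝ)⁻¹ * ∑ j, (G j ω).real s

theorem measurable_measureReal {s : Set ℝ} (hs : MeasurableSet s) :
    Measurable fun μ : Measure ℝ => μ.real s :=
  (Measure.measurable_coe hs).ennreal_toReal

theorem measurable_averageReal {G : J → Ω → Measure ℝ} (hG : ∀ j, Measurable (G j)) {s : Set ℝ}
    (hs : MeasurableSet s) : Measurable (averageReal G s) :=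
  (Finset.measurable_fun_sum _ fun j _ => (measurable_measureReal hs).comp (hG j)).const_mul _

/-- Hoeffding's inequality for the average of independent random measures. -/
theorem measureReal_abs_averageReal_sub_gt_le [Nonempty J] {G : J → Ω → Measure ℝ} (hG : ∀ j, Measurable (G j))
    [∀ j ω, IsProbabilityMeasure (G j ω)] (hind : iIndepFun G P) {ρ : Measure ℝ}
    (hρ : ∀ j, P.bind (G j) = ρ) {s : Set ℝ} (hs : MeasurableSet s) {ε : ℝ} (hε : 0 ≤ ε) :
    P.real {ω | ε < |averageReal G s ω - ρ.real s|} ≤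
      2 * Real.exp (-(2 * Fintype.card J * ε ^ 2)) := by
  set L : ℝ := (Fintype.card J : ℝ) with hL
  have hL0 : 0 < L := by
    have := Fintype.card_pos (α := J)
    positivity
  -- Hoeffding's variance proxy `1/4` for variables with values in `[0, 1]`.
  let c : NNReal := (‖(1 : ℝ) - 0‖₊ / 2) ^ 2
  have hc : (c : ℝ) = 1 / 4 := by
    simp [c]
    norm_num
  let X : J → Ω → ℝ := fun j ω => (G j ω).real s - ρ.real s
  have hX : ∀ j, HasSubgaussianMGF (X j) c P := fun j => by
    have h1 := hasSubgaussianMGF_of_mem_Icc (μ := P) (X := fun ω => (G j ω).real s) (a := 0)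
      (b := 1) ((measurable_measureReal hs).comp (hG j)).aemeasurable
      (.of_forall fun ω => ⟨measureReal_nonneg, measureReal_le_one⟩)
    have h2 : ∫ ω, (G j ω).real s ∂P = ρ.real s := by
      rw [← measureReal_bind P (hG j) hs, hρ]
    rw [h2] at h1
    exact h1
  have hXi : iIndepFun X P :=
    hind.comp (fun _ μ => μ.real s - ρ.real s) fun _ => (measurable_measureReal hs).sub_const _
  have hXn : iIndepFun (fun j => -X j) P :=
    hind.comp (fun _ μ => -(μ.real s - ρ.real s))
      fun _ => ((measurable_measureReal hs).sub_const _).neg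
  have hexp : -(L * ε) ^ 2 / (2 * ((∑ _j : J, c : NNReal) : ℝ)) = -(2 * L * ε ^ 2) := by
    simp only [Finset.sum_const, Finset.card_univ, nsmul_eq_mul]
    push_cast
    rw [hc, ← hL]
    field_simp
    ring
  have h1 := HasSubgaussianMGF.measure_sum_ge_le_of_iIndepFun hXi (s := Finset.univ)
    (fun j _ => hX j) (ε := L * ε) (by positivity)
  have h2 := HasSubgaussianMGF.measure_sum_ge_le_of_iIndepFun hXn (s := Finset.univ)
    (fun j _ => (hX j).neg) (ε := L * ε) (by positivity)
  rw [hexp] at h1 h2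
  have hsum : ∀ ω, ∑ j, X j ω = L * (averageReal G s ω - ρ.real s) := fun ω => by
    simp only [X, Finset.sum_sub_distrib, Finset.sum_const, Finset.card_univ, nsmul_eq_mul,
      averageReal, ← hL]
    field_simp
  have hsub : {ω | ε < |averageReal G s ω - ρ.real s|} ⊆
      {ω | L * ε ≤ ∑ j, X j ω} ∪ {ω | L * ε ≤ ∑ j, (-X j) ω} := by
    intro ω (hω : ε < |averageReal G s ω - ρ.real s|)
    simp only [Set.mem_union, Set.mem_ofPred_eq, Pi.neg_apply, Finset.sum_neg_distrib, hsum]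
    rcases lt_abs.1 hω with h | h
    · left
      gcongr
    · right
      rw [← mul_neg]
      gcongr
  exact (measureReal_mono hsub).trans ((measureReal_union_le _ _).trans (by linarith))

/-- A uniform law of large numbers for averages of independent random measures with the same
mean. -/
theorem exists_measurableSet_forall_abs_averageReal_sub_le [Nonempty J] {G : J → Ω → Measure ℝ}
    (hG : ∀ j, Measurable (G j)) [∀ j ω, IsProbabilityMeasure (G j ω)] (hind : iIndepFun G P)
    {ρ : Measure ℝ} [IsProbabilityMeasure ρ] (hρ : ∀ j, P.bind (G j) = ρ) {ε : ℝ} (hε : 0 ≤ ε)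
    {N : ℕ} (hN : 0 < N) :
    ∃ A : Set Ω, MeasurableSet A ∧
      (∀ ω ∈ A, ∀ x, |averageReal G (Set.Iic x) ω - ρ.real (Set.Iic x)| ≤ ε + 1 / N) ∧
      1 - 4 * N * Real.exp (-(2 * Fintype.card J * ε ^ 2)) ≤ P.real A := by
  obtain ⟨T, hTN, hT⟩ := exists_finset_control ρ hN
  let bad : Set ℝ → Set Ω := fun s => {ω | ε < |averageReal G s ω - ρ.real s|}
  have hbad : ∀ s, MeasurableSet s → MeasurableSet (bad s) := fun s hs =>
    measurableSet_lt measurable_const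
      (continuous_abs.measurable.comp ((measurable_averageReal hG hs).sub_const _))
  let B : Set Ω := ⋃ t ∈ T, (bad (Set.Iic t) ∪ bad (Set.Iio t))
  have hB : MeasurableSet B := Finset.measurableSet_biUnion _ fun t _ =>
    (hbad _ measurableSet_Iic).union (hbad _ measurableSet_Iio)
  refine ⟨Bᶜ, hB.compl, fun ω hω x => ?_, ?_⟩
  · have hmono : ∀ s t : Set ℝ, s ⊆ t → averageReal G s ω ≤ averageReal G t ω := fun s t hst =>
      mul_le_mul_of_nonneg_left (Finset.sum_le_sum fun j _ => measureReal_mono hst) (by positivity)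
    refine hT (fun x => averageReal G (Set.Iic x) ω) (fun x => averageReal G (Set.Iio x) ω) ε hε
      (fun x y hxy => hmono _ _ (Set.Iic_subset_Iic.2 hxy))
      (fun x t hxt => hmono _ _ fun y (hy : y ≤ x) => hy.trans_lt hxt)
      (fun x => mul_nonneg (by positivity) (Finset.sum_nonneg fun j _ => measureReal_nonneg))
      (fun x => ?_) (fun t ht => ?_) x
    · rw [averageReal, inv_mul_le_iff₀ (by exact_mod_cast Fintype.card_pos)]
      refine (Finset.sum_le_sum fun j _ => measureReal_le_one).trans_eq ?_
      simp
    · simp only [B, Set.mem_compl_iff, Set.mem_iUnion, not_exists, Set.mem_union, not_or, bad,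
        Set.mem_ofPred_eq, not_lt] at hω
      exact hω t ht
  -- Union bound: at most `N` points, two half-lines at each, two tails for each half-line, hence
  -- the factor `4 * N`.
  · have h1 : P.real B ≤ ∑ _t ∈ T, (2 * Real.exp (-(2 * Fintype.card J * ε ^ 2)) +
        2 * Real.exp (-(2 * Fintype.card J * ε ^ 2))) := by
      refine (measureReal_biUnion_finset_le _ _).trans (Finset.sum_le_sum fun t _ => ?_)
      refine (measureReal_union_le _ _).trans (add_le_add ?_ ?_)
      · exact measureReal_abs_averageReal_sub_gt_le hG hind hρ measurableSet_Iic hε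
      · exact measureReal_abs_averageReal_sub_gt_le hG hind hρ measurableSet_Iio hε
    rw [Finset.sum_const, nsmul_eq_mul] at h1
    rw [probReal_compl_eq_one_sub hB]
    have h2 : (T.card : ℝ) ≤ N := by exact_mod_cast hTN
    have h3 := Real.exp_pos (-(2 * Fintype.card J * ε ^ 2))
    have h4 := mul_le_mul_of_nonneg_right h2 h3.le
    linarith

end GlivenkoCantelli

/-! ### Independence of block eigenvalue distributions. -/

section Independence

variable {d : ℕ}

/-- Extension of a configuration on a finite set by zero. -/
def extendConfig (Λ : Finset (Site d)) (v : Λ → ℝ) : Config d :=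
  fun x => if h : x ∈ Λ then v ⟨x, h⟩ else 0

theorem measurable_extendConfig (Λ : Finset (Site d)) : Measurable (extendConfig Λ) := by
  refine measurable_pi_lambda _ fun x => ?_
  by_cases h : x ∈ Λ
  · simp only [extendConfig, dif_pos h]
    exact measurable_pi_apply _
  · simp only [extendConfig, dif_neg h]
    exact measurable_const

theorem empiricalMeasure_congr {ι : Type*} [Fintype ι] [DecidableEq ι] {A B : Matrix ι ι ℂ}
    (hA : A.IsHermitian) (hB : B.IsHermitian) (h : A = B) :
    empiricalMeasure hA = empiricalMeasure hB := by
  subst h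
  rfl

theorem eigenvalueMeasure_extendConfig_restrict (Λ : Finset (Site d)) (ω : Config d) :
    eigenvalueMeasure Λ (extendConfig Λ (Λ.restrict ω)) = eigenvalueMeasure Λ ω := by
  refine empiricalMeasure_congr _ _ ?_
  ext x y
  simp [restrictedMatrix_apply, extendConfig]

/-- The eigenvalues of a block depend only on the potential inside it; extension by zero exhibits
them as a measurable function of the restricted configuration. -/
theorem IndependentAtDistance.iIndepFun_eigenvalueMeasure {P : Measure (Config d)} {r : ℝ}
    (hP : IndependentAtDistance P r) {J : Type*} [Fintype J] {Λ : J → Finset (Site d)}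
    (hne : ∀ j, (Λ j).Nonempty)
    (hdist : ∀ i j, i ≠ j → ∀ x ∈ Λ i, ∀ y ∈ Λ j, r < (latticeDist x y : ℝ)) :
    iIndepFun (fun j => eigenvalueMeasure (Λ j)) P := by
  let e := Fintype.equivFin J
  have h1 := hP _ (fun i => Λ (e.symm i)) (fun i => hne _)
    (fun i j hij => hdist _ _ fun h => hij (e.symm.injective h))
  have h2 : iIndepFun (fun (j : Fin (Fintype.card J)) => eigenvalueMeasure (Λ (e.symm j))) P := by
    have := h1.comp (fun i v => eigenvalueMeasure (Λ (e.symm i)) (extendConfig _ v)) fun i =>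
      (measurable_eigenvalueMeasure (hne _)).comp (measurable_extendConfig _)
    refine this.congr fun i => .of_forall fun ω => ?_
    exact eigenvalueMeasure_extendConfig_restrict _ ω
  have h3 := h2.precomp e.injective
  simpa using h3

end Independence

end Anderson

namespace Anderson

/-! ### The constant `K_M`, the tail comparison and the error budget. -/

section Constants

theorem seriesTerm_nonneg (q : ℕ) : 0 ≤ seriesTerm q := by
  unfold seriesTerm
  positivity

theorem hasSum_seriesTerm_majorant :
    HasSum (fun q : ℕ => 3 / 2 * (2 : ℝ)⁻¹ ^ q + Real.log 2 / 2 * (q * (2 : ℝ)⁻¹ ^ q))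
      (3 + Real.log 2) := by
  have h1 := (hasSum_geometric_of_norm_lt_one (ξ := (2 : ℝ)⁻¹) (by norm_num)).mul_left (3 / 2 : ℝ)
  have h2 := (hasSum_coe_mul_geometric_of_norm_lt_one (r := (2 : ℝ)⁻¹) (by norm_num)).mul_left
    (Real.log 2 / 2)
  have h3 : 3 / 2 * (1 - (2 : ℝ)⁻¹)⁻¹ + Real.log 2 / 2 * ((2 : ℝ)⁻¹ / (1 - (2 : ℝ)⁻¹) ^ 2) =
      3 + Real.log 2 := by
    norm_num
  rw [← h3]
  exact h1.add h2

/-- The tangent bound `√(2 + 2t) ≤ 3/2 + t/2`, with contact at `t = 1`, applied to `t = q log 2`.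
The majorant sums to `3 + log 2 < 4`. -/
theorem seriesTerm_le (q : ℕ) :
    seriesTerm q ≤ 3 / 2 * (2 : ℝ)⁻¹ ^ q + Real.log 2 / 2 * (q * (2 : ℝ)⁻¹ ^ q) := by
  have hlog := Real.log_nonneg one_le_two
  have h1 : √(2 + 2 * (q : ℝ) * Real.log 2) ≤ 3 / 2 + Real.log 2 / 2 * q := by
    rw [Real.sqrt_le_left (by positivity)]
    nlinarith [sq_nonneg (1 / 2 - Real.log 2 / 2 * q)]
  calc seriesTerm q ≤ (2 : ℝ)⁻¹ ^ q * (3 / 2 + Real.log 2 / 2 * q) := by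
        unfold seriesTerm
        gcongr
    _ = _ := by ring

theorem summable_seriesTerm : Summable seriesTerm :=
  .of_nonneg_of_le seriesTerm_nonneg seriesTerm_le hasSum_seriesTerm_majorant.summable

theorem tsum_seriesTerm_lt : ∑' q, seriesTerm q < 4 := by
  have h := summable_seriesTerm.tsum_le_tsum seriesTerm_le hasSum_seriesTerm_majorant.summable
  rw [hasSum_seriesTerm_majorant.tsum_eq] at h
  linarith [Real.log_two_lt_d9]

theorem one_le_tsum_seriesTerm : 1 ≤ ∑' q, seriesTerm q := by
  refine le_trans ?_ (summable_seriesTerm.le_tsum 0 fun q _ => seriesTerm_nonneg q)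
  simp [seriesTerm, Real.one_le_sqrt]

theorem log_three_halves_pos : 0 < Real.log (3 / 2) := Real.log_pos (by norm_num)

theorem forty_le_prefactor {M : ℝ} (hM : 2 ≤ M) :
    40 ≤ 40 * (M + 1) / (Real.log (3 / 2) * (M - 1)) + 4 / Real.log M := by
  have h1 : 0 < Real.log M := Real.log_pos (by linarith)
  have h2 : Real.log (3 / 2) ≤ 1 := by
    have := Real.log_le_sub_one_of_pos (show (0 : ℝ) < 3 / 2 by norm_num)
    linarith
  have h3 := log_three_halves_pos
  have h4 : 40 ≤ 40 * (M + 1) / (Real.log (3 / 2) * (M - 1)) := by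
    rw [le_div_iff₀ (mul_pos h3 (by linarith))]
    have := mul_le_of_le_one_left (show 0 ≤ M - 1 by linarith) h2
    linarith
  have h5 : 0 ≤ 4 / Real.log M := by positivity
  linarith

theorem one_le_constK {M : ℝ} (hM : 2 ≤ M) : 1 ≤ constK M := by
  have h1 := forty_le_prefactor hM
  have h2 := one_le_tsum_seriesTerm
  unfold constK
  nlinarith

theorem constK_lt {M : ℝ} (hM : 2 ≤ M) :
    constK M < 16 * (10 * (M + 1) / (Real.log (3 / 2) * (M - 1)) + 1 / Real.log M) := by
  have h1 := forty_le_prefactor hM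
  have h2 := mul_lt_mul_of_pos_left tsum_seriesTerm_lt (lt_of_lt_of_le (by norm_num) h1)
  unfold constK
  refine h2.trans_eq ?_
  ring

/-- The Gaussian tail dominates the exponential one. -/
theorem four_mul_exp_le {m s K M : ℝ} (hs : 2 ≤ s) (hms : m ≤ s ^ 2) (hK : 1 ≤ K) (hM : 2 ≤ M) :
    4 * m * Real.exp (-(2 * s ^ 2)) ≤ M * Real.exp (-(s / K)) := by
  have h1 : s / K ≤ s := div_le_self (by linarith) hK
  -- Half of the Gaussian exponent absorbs `s`; the quadratic lower bound for `exp (s ^ 2)` then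
  -- beats `2 * s ^ 2` because `s ^ 2 ≥ 4`.
  have h2 : 2 * s ^ 2 ≤ Real.exp (2 * s ^ 2 - s) := by
    have h3 := Real.quadratic_le_exp_of_nonneg (sq_nonneg s)
    have h4 : Real.exp (s ^ 2) ≤ Real.exp (2 * s ^ 2 - s) := Real.exp_le_exp.2 (by nlinarith)
    nlinarith [mul_nonneg (sq_nonneg s) (show 0 ≤ s ^ 2 - 4 by nlinarith)]
  calc 4 * m * Real.exp (-(2 * s ^ 2)) ≤ 2 * (2 * s ^ 2) * Real.exp (-(2 * s ^ 2)) := by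
        exact mul_le_mul_of_nonneg_right (by linarith) (Real.exp_pos _).le
    _ ≤ 2 * Real.exp (2 * s ^ 2 - s) * Real.exp (-(2 * s ^ 2)) := by gcongr
    _ = 2 * Real.exp (-s) := by
        rw [mul_assoc, ← Real.exp_add]
        congr 2
        ring
    _ ≤ M * Real.exp (-(s / K)) := by gcongr

theorem one_sub_pow_le {y : ℝ} (hy : 0 ≤ y) (d : ℕ) : 1 - y ^ d ≤ d * (1 - y) := by
  have := one_add_mul_le_pow (a := y - 1) (by linarith) d
  rw [add_sub_cancel] at this
  linarith

/-- The sum of the tiling, averaging and discretization errors is within the asserted bound. -/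
theorem error_le {d n m k g ℓ : ℕ} (hd : 1 ≤ d) {r : ℝ} (hr : 0 ≤ r) (hn : 16 < n)
    (hm : m = Nat.sqrt n) (hk : k = n / m) (hg : (g : ℝ) ≤ r + 1) (hgm : 2 * g ≤ m)
    (hℓ : ℓ + g = m) :
    1 - (k * ℓ / n : ℝ) ^ d + (1 / m + 1 / m) + 2 * (1 - (ℓ / (ℓ + 1) : ℝ) ^ d) ≤
      32 * (d : ℝ) * (1 / (n : ℝ)) + 104 * ((2 : ℝ) ^ d - 1) * (1 / √(n : ℝ))
        + (8 * (d : ℝ) + 4 * r * ((2 : ℝ) ^ d - 1) + 72 * (d : ℝ) * r + 1)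
          * (1 / (√(n : ℝ) - 1)) := by
  have hn0 : (0 : ℝ) < n := by exact_mod_cast (by omega : 0 < n)
  have hm4 : 4 ≤ m := hm ▸ Nat.le_sqrt.2 (by omega)
  have hm0 : (0 : ℝ) < m := by exact_mod_cast (by omega : 0 < m)
  have hsq : (m : ℝ) ≤ √n := by
    rw [hm]
    exact Real.nat_sqrt_le_real_sqrt
  have hsq' : √(n : ℝ) < m + 1 := by
    rw [hm]
    exact Real.real_sqrt_lt_nat_sqrt_succ
  have hs0 : 0 < √(n : ℝ) := Real.sqrt_pos.2 hn0
  have hs1 : 0 < √(n : ℝ) - 1 := by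
    have : (4 : ℝ) ≤ m := by exact_mod_cast hm4
    linarith
  have hinv : 1 / (m : ℝ) ≤ 1 / (√(n : ℝ) - 1) := by
    gcongr
    linarith
  have hkm : (k * m : ℝ) ≤ n := by
    rw [hk]
    exact_mod_cast Nat.div_mul_le_self n m
  have hkm' : (n : ℝ) ≤ k * m + m := by
    have := Nat.lt_div_mul_add (a := n) (b := m) (by omega)
    rw [hk]
    exact_mod_cast this.le
  have hℓm : (ℓ : ℝ) = m - g := by
    rw [← hℓ]
    push_cast
    ring
  have hℓ2 : (m : ℝ) ≤ 2 * ℓ := by exact_mod_cast (by omega : m ≤ 2 * ℓ)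
  -- In one dimension the lost fraction is at most `m / n` for the leftover strip plus `g / m` for
  -- the corridors; Bernoulli's inequality then multiplies it by `d`.
  have e1 : 1 - (k * ℓ / n : ℝ) ≤ 1 / √n + g * (1 / m) := by
    have h1 : (m / n : ℝ) ≤ 1 / √n := by
      rw [div_le_div_iff₀ hn0 hs0, one_mul]
      nlinarith [Real.mul_self_sqrt hn0.le]
    have h2 : (k * g / n : ℝ) ≤ g * (1 / m) := by
      rw [mul_one_div, div_le_div_iff₀ hn0 hm0]
      nlinarith [(Nat.cast_nonneg g : (0 : ℝ) ≤ g)]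
    have h3 : 1 - (k * ℓ / n : ℝ) ≤ m / n + k * g / n := by
      rw [← add_div, one_sub_div hn0.ne', hℓm]
      gcongr
      linarith
    linarith
  have e2 : 1 - (ℓ / (ℓ + 1) : ℝ) ≤ 2 * (1 / m) := by
    rw [one_sub_div (by positivity), mul_one_div, div_le_div_iff₀ (by positivity) hm0]
    linarith
  have f1 := one_sub_pow_le (show 0 ≤ (k * ℓ / n : ℝ) by positivity) d
  have f2 := one_sub_pow_le (show 0 ≤ (ℓ / (ℓ + 1) : ℝ) by positivity) d
  have hd' : (1 : ℝ) ≤ d := by exact_mod_cast hd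
  have f3 := mul_le_mul_of_nonneg_left e1 (zero_le_one.trans hd')
  have f4 := mul_le_mul_of_nonneg_left e2 (zero_le_one.trans hd')
  have hpow : (d : ℝ) ≤ (2 : ℝ) ^ d - 1 := by
    have := one_add_mul_le_pow (a := (1 : ℝ)) (by norm_num) d
    norm_num at this
    linarith
  have g1 : (d : ℝ) * (1 / √n) ≤ 104 * ((2 : ℝ) ^ d - 1) * (1 / √n) := by
    gcongr
    linarith
  -- The terms of order `1 / m`: corridors `d * g`, concentration and discretization `2`, comparison
  -- with the integrated density of states `4 * d`.
  have g2 : (d * g + 2 + 4 * d : ℝ) * (1 / m) ≤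
      (8 * (d : ℝ) + 4 * r * ((2 : ℝ) ^ d - 1) + 72 * (d : ℝ) * r + 1) * (1 / (√(n : ℝ) - 1)) := by
    have h1 : (d * g : ℝ) ≤ d * r + d := by nlinarith
    have h2 : 0 ≤ r * ((2 : ℝ) ^ d - 1) := mul_nonneg hr (by linarith)
    have h3 : 0 ≤ d * r := mul_nonneg (by linarith) hr
    exact mul_le_mul (by linarith) hinv (by positivity) (by linarith)
  have g3 : 0 ≤ 32 * (d : ℝ) * (1 / (n : ℝ)) := by positivity
  linarith

end Constants

end Anderson
-- Choice of parameters and conclusion.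
theorem mainTheorem1 (d : ℕ) (hd : 3 ≤ d) (M : ℝ) (hM : 2 ≤ M)
    (P : Measure (Anderson.Config d)) [IsProbabilityMeasure P]
    (hP : Anderson.TranslationInvariant P)
    (r : ℝ) (hr : 0 ≤ r) (hPr : Anderson.IndependentAtDistance P r) :
    (Summable Anderson.seriesTerm ∧
      Anderson.constK M <
        16 * (10 * (M + 1) / (Real.log (3 / 2) * (M - 1)) + 1 / Real.log M)) ∧
    ∀ (n : ℕ) (a : Anderson.Site d), (2 * r + 1) ^ 2 < (n : ℝ) → 16 < n →
      ∃ A : Set (Anderson.Config d), MeasurableSet A ∧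
        (∀ ω ∈ A, ∀ x : ℝ,
          |Anderson.normEvcf (Anderson.cube a n) ω x - Anderson.ids P x| ≤
            32 * (d : ℝ) * (1 / (n : ℝ)) + 104 * ((2 : ℝ) ^ d - 1) * (1 / √(n : ℝ))
              + (8 * (d : ℝ) + 4 * r * ((2 : ℝ) ^ d - 1) + 72 * (d : ℝ) * r + 1)
                * (1 / (√(n : ℝ) - 1))) ∧
        P.real A ≥ 1 - M * Real.exp
          (-(√(((n / Nat.sqrt n : ℕ) : ℝ) ^ d) / ((Nat.sqrt n : ℝ) * Anderson.constK M))) := by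
  refine ⟨⟨Anderson.summable_seriesTerm, Anderson.constK_lt hM⟩, fun n a hrn hn => ?_⟩
  set m := Nat.sqrt n with hm
  set k := n / m with hk
  -- Distinct blocks have integer distance at least `g + 1`: this exceeds `r`, for independence, and
  -- `1`, for decoupling.
  set g := max 1 ⌊r⌋₊ with hg
  have hm4 : 4 ≤ m := Nat.le_sqrt.2 (by omega)
  have hmk : m ≤ k := (Nat.le_div_iff_mul_le (by omega)).2 (Nat.sqrt_le n)
  -- The lower bound on `n` keeps the corridors within half a tile.
  have hrm : 2 * r < m := by
    have h1 : 2 * r + 1 < √(n : ℝ) := (Real.lt_sqrt (by linarith)).2 hrn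
    have h2 : √(n : ℝ) < m + 1 := Real.real_sqrt_lt_nat_sqrt_succ
    linarith
  have hgm : 2 * g ≤ m := by
    have h1 : (⌊r⌋₊ : ℝ) ≤ r := Nat.floor_le hr
    have h2 : 2 * ⌊r⌋₊ < m := by
      have : (2 * ⌊r⌋₊ : ℝ) < m := by linarith
      exact_mod_cast this
    omega
  have hgr : (g : ℝ) ≤ r + 1 := by
    rw [hg, Nat.cast_max, max_le_iff]
    have := Nat.floor_le hr
    constructor
    · push_cast
      linarith
    · linarith
  have hrg : r < g + 1 := by
    have h1 : (⌊r⌋₊ : ℝ) ≤ g := by exact_mod_cast le_max_right 1 _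
    linarith [Nat.lt_floor_add_one r]
  have hg1 : 0 < g := lt_of_lt_of_le one_pos (le_max_left _ _)
  obtain ⟨ℓ, hℓ⟩ : ∃ ℓ, ℓ + g = m := ⟨m - g, by omega⟩
  have hℓ0 : 0 < ℓ := by omega
  have hkn : k * (ℓ + g) ≤ n := by
    rw [hℓ]
    exact Nat.div_mul_le_self n m
  let Λ : (Fin d → Fin k) → Finset (Anderson.Site d) := fun j =>
    Anderson.cube (Anderson.corner a (ℓ + g) j) ℓ
  have hne : ∀ j, (Λ j).Nonempty := fun j => Anderson.cube_nonempty _ hℓ0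
  have hprob : ∀ j ω, IsProbabilityMeasure (Anderson.eigenvalueMeasure (Λ j) ω) := fun j =>
    Anderson.isProbabilityMeasure_eigenvalueMeasure (hne j)
  have hind := hPr.iIndepFun_eigenvalueMeasure hne fun i j hij x hx y hy => by
    have h1 := Anderson.lt_latticeDist_of_mem_cube_corner a hij hx hy
    have h2 : ((g + 1 : ℤ) : ℝ) ≤ Anderson.latticeDist x y := by exact_mod_cast h1
    push_cast at h2
    linarith
  have hne0 := Anderson.cube_nonempty (0 : Anderson.Site d) hℓ0
  have hprob0 := Anderson.isProbabilityMeasure_eigenvalueMeasure hne0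
  have hρ := Anderson.isProbabilityMeasure_bind P (Anderson.measurable_eigenvalueMeasure hne0)
  have : Nonempty (Fin k) := ⟨⟨0, by omega⟩⟩
  obtain ⟨A, hA, hAx, hAP⟩ := Anderson.exists_measurableSet_forall_abs_averageReal_sub_le
    (fun j => Anderson.measurable_eigenvalueMeasure (hne j)) hind
    (fun j => Anderson.bind_eigenvalueMeasure_cube hP _ hℓ0)
    -- Deviation and quantile spacing are both set to `1 / m`, the order of the corridor error.
    (ε := 1 / m) (by positivity) (N := m) (by omega)
  refine ⟨A, hA, fun ω hω x => ?_, ?_⟩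
  · have h1 := Anderson.abs_normEvcf_cube_sub_average_le a hℓ0 hg1 (by omega) hkn ω x
    have h2 := hAx ω hω x
    have h3 := Anderson.abs_ids_sub_le hP hℓ0 x
    simp only [Anderson.averageReal, Anderson.eigenvalueMeasure_real_Iic, Fintype.card_fun,
      Fintype.card_fin, Nat.cast_pow, Λ] at h2
    refine le_trans ?_ (Anderson.error_le (by omega) hr hn hm hk hgr hgm hℓ)
    rw [abs_sub_comm] at h3
    exact (abs_sub_le _ _ _).trans (add_le_add ((abs_sub_le _ _ _).trans (add_le_add h1 h2)) h3)
  · refine le_trans (sub_le_sub_left ?_ 1) hAP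
    have hm0 : (0 : ℝ) < m := by exact_mod_cast (by omega : 0 < m)
    -- Here `d ≥ 3` enters: it gives `m ≤ s ^ 2`, which lets the Gaussian tail absorb the prefactor
    -- `4 * m` of the union bound.
    have hL : (m : ℝ) ^ 3 ≤ (k : ℝ) ^ d := by
      exact_mod_cast (Nat.pow_le_pow_right (by omega) hd).trans (Nat.pow_le_pow_left hmk d)
    set s := √((k : ℝ) ^ d) / m with hs
    have hs2 : s ^ 2 = (k : ℝ) ^ d / m ^ 2 := by rw [hs, div_pow, Real.sq_sqrt (by positivity)]
    have hms : (m : ℝ) ≤ s ^ 2 := by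
      rw [hs2, le_div_iff₀ (by positivity)]
      linarith [pow_succ' (m : ℝ) 2]
    have hs4 : 2 ≤ s := by
      refine le_of_sq_le_sq ?_ (by positivity)
      have : (4 : ℝ) ≤ m := by exact_mod_cast hm4
      linarith
    have h := Anderson.four_mul_exp_le hs4 hms (Anderson.one_le_constK hM) hM
    rw [hs2, hs, div_div] at h
    have hexp : 2 * (Fintype.card (Fin d → Fin k) : ℝ) * (1 / m) ^ 2 =
        2 * ((k : ℝ) ^ d / m ^ 2) := by
      rw [Fintype.card_fun, Fintype.card_fin, Fintype.card_fin, Nat.cast_pow]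
      ring
    rw [hexp]
    exact h
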